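/- Let $\mathbb{D}\subset\mathbb{R}^2$ be the open unit disc and let $H^1_{rad,0}(\mathbb{D})$ be the space of radial complex-valued functions in $H^1(\mathbb{D})$ vanishing on $\partial\mathbb{D}$, regarded as a real Hilbert space with inner product $\langle u,v\rangle_{\dot H^1}=\mathrm{Re}\int_{\mathbb{D}}\nabla u\cdot\overline{\nabla v}\,dx$. Write $\langle f,g\rangle=\mathrm{Re}\int_{\mathbb{D}}f\bar g\,dx$, and let $(-\Delta)^{-1}$ be the solution operator of the Dirichlet problem $-\Delta u=f$ in $\mathbb{D}$, $u=0$ on $\partial\mathbb{D}$. Let $Q$ be the ground state, i.e. the positive, radial, exponentially decaying smooth solution of $\Delta Q+Q^3-Q=0$ on $\mathbb{R}^2$. For $\delta>0$ put $Q_\delta(x)=\delta^{-1}Q(\delta^{-1}x)$ and $\mathbf{Q}_\delta(x)=Q_\delta(x)-Q_\delta(1)$, where $Q_\delta(1)$ is the value of $Q_\delta$ on the unit circle. Let $$W_R=\{w\in H^1_{rad,0}(\mathbb{D})\text{ real-valued}:\ \langle w,(-\Delta)\partial_\delta\mathbf{Q}_\delta\rangle=\langle w,\mathbf{Q}_\delta\rangle=0\},$$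 $$W_I=\{w\in H^1_{rad,0}(\mathbb{D})\text{ purely imaginary-valued}:\ \langle w,(-\Delta)(i\mathbf{Q}_\delta)\rangle=0\},$$ let $P_{W_R},P_{W_I}$ be the $\dot H^1$-orthogonal projections onto $W_R,W_I$, and for $\eta>0$ define the operators on $H^1_{rad,0}(\mathbb{D})$ $$A_1=P_{W_R}(-\Delta)^{-1}\Big(-(1+5\eta)\tfrac32\mathbf{Q}_\delta^2+\tfrac{\delta^{-2}}2\Big)P_{W_R},\qquad A_2=P_{W_I}(-\Delta)^{-1}\Big(-(1+5\eta)\tfrac12\mathbf{Q}_\delta^2+\tfrac{\delta^{-2}}2\Big)P_{W_I}.$$ Proposition. For every $\eta_0>0$ there are $\delta_0,c,C>0$ such that for all $\eta\in(0,\eta_0]$, all $\delta\in(0,\delta_0)$ and each $A\in\{A_1,A_2\}$: the non-zero eigenvalues of $A$, repeated according to multiplicity, can be listed as two infinite sequences $\lambda^-_1\le\lambda^-_2\le\cdots<0<\cdots\le\lambda^+_2\le\lambda^+_1$, and for all $n\ge1$ $$\lambda_n^+\ \ge\ c\,\frac{\delta^{-2}}{n^2},\qquad \lambda_n^-\ \ge\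 -\frac{C}{n^2}.$$ -/

import Mathlib

open MeasureTheory
open scoped ENNReal ContDiff InnerProductSpace Laplacian

namespace RadialDisc

/-- The Euclidean plane. -/
abbrev Plane : Type := EuclideanSpace ℝ (Fin 2)

/-- Lebesgue measure on the open unit disc `𝔻`. -/
noncomputable def discMeasure : Measure Plane := volume.restrict (Metric.ball (0 : Plane) 1)

instance : IsFiniteMeasure discMeasure := by
  unfold discMeasure
  exact ⟨by simp⟩

/-- Complex-valued `L²(𝔻)`, a real Hilbert space for `⟪f, g⟫_ℝ = Re ∫ f * conj g`. -/
abbrev L2Disc : Type := Lp ℂ 2 discMeasure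

/-- The `i`-th classical partial derivative. -/
noncomputable def partialDeriv (i : Fin 2) (φ : Plane → ℂ) (x : Plane) : ℂ :=
  fderiv ℝ φ x (EuclideanSpace.single i (1 : ℝ))

/-- Pairs `(φ, ∇φ)` with `φ` a complex-valued test function, `φ ∈ C_c^∞(𝔻)`. -/
def testPairs : Submodule ℝ (L2Disc × (Fin 2 → L2Disc)) where
  carrier := {p | ∃ φ : Plane → ℂ, ContDiff ℝ ∞ φ ∧ HasCompactSupport φ ∧
    tsupport φ ⊆ Metric.ball (0 : Plane) 1 ∧
    p.1 =ᵐ[discMeasure] φ ∧ ∀ i, p.2 i =ᵐ[discMeasure] partialDeriv i φ}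
  zero_mem' := by
    refine ⟨0, contDiff_const, HasCompactSupport.zero, by simp [tsupport], ?_, fun i => ?_⟩
    · exact Lp.coeFn_zero _ _ _
    · have h : partialDeriv i (0 : Plane → ℂ) = 0 := by
        funext x; simp [partialDeriv]
      rw [h]; exact Lp.coeFn_zero _ _ _
  add_mem' := by
    rintro p q ⟨φ, h1, h2, h3, h4, h5⟩ ⟨ψ, k1, k2, k3, k4, k5⟩
    refine ⟨φ + ψ, h1.add k1, h2.add k2, ?_, ?_, fun i => ?_⟩
    · exact (tsupport_add φ ψ).trans (Set.union_subset h3 k3)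
    · exact (Lp.coeFn_add _ _).trans (h4.add k4)
    · have h : partialDeriv i (φ + ψ) = partialDeriv i φ + partialDeriv i ψ := by
        funext x
        simp only [partialDeriv, Pi.add_apply]
        rw [fderiv_add (h1.differentiable (by simp) x) (k1.differentiable (by simp) x)]
        rfl
      rw [h]
      exact (Lp.coeFn_add _ _).trans ((h5 i).add (k5 i))
  smul_mem' := by
    rintro c p ⟨φ, h1, h2, h3, h4, h5⟩
    refine ⟨c • φ, h1.const_smul c, h2.smul_left (f := fun _ => c), ?_, ?_, fun i => ?_⟩
    · exact (closure_mono (Function.support_const_smul_subset c φ)).trans h3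
    · exact (Lp.coeFn_smul _ _).trans (h4.const_smul c)
    · have h : partialDeriv i (c • φ) = c • partialDeriv i φ := by
        funext x
        simp only [partialDeriv, Pi.smul_apply]
        rw [fderiv_const_smul (h1.differentiable (by simp) x)]
        rfl
      rw [h]
      exact (Lp.coeFn_smul _ _).trans ((h5 i).const_smul c)

/-- `H¹₀(𝔻)`: the closure of the test functions in `H¹(𝔻)`, each function being recorded together
with its weak gradient as a pair `(u, ∇u)`. -/
noncomputable def sobolevZero : Submodule ℝ (L2Disc × (Fin 2 → L2Disc)) :=
  testPairs.topologicalClosure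

/-- Pairs whose first component is (a.e. equal to) a function of `‖x‖`. -/
def radialPairs : Submodule ℝ (L2Disc × (Fin 2 → L2Disc)) where
  carrier := {p | ∃ f : ℝ → ℂ, ∀ᵐ x ∂discMeasure, p.1 x = f ‖x‖}
  zero_mem' := ⟨0, Lp.coeFn_zero _ _ _⟩
  add_mem' := by
    rintro p q ⟨f, hf⟩ ⟨g, hg⟩
    refine ⟨f + g, ?_⟩
    filter_upwards [hf, hg, Lp.coeFn_add p.1 q.1] with x h1 h2 h3
    simp only [Prod.fst_add, Pi.add_apply] at h3 ⊢
    rw [h3, h1, h2]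
  smul_mem' := by
    rintro c p ⟨f, hf⟩
    refine ⟨c • f, ?_⟩
    filter_upwards [hf, Lp.coeFn_smul c p.1] with x h1 h3
    simp only [Prod.smul_fst, Pi.smul_apply] at h3 ⊢
    rw [h3, h1]

lemma isClosed_radialPairs :
    IsClosed (radialPairs : Set (L2Disc × (Fin 2 → L2Disc))) := by
  rw [← isSeqClosed_iff_isClosed]
  intro p q hp hpq
  choose f hf using hp
  have h1 : Filter.Tendsto (fun n => (p n).1) Filter.atTop (nhds q.1) :=
    (continuous_fst.tendsto q).comp hpq
  obtain ⟨ns, -, hns⟩ := (tendstoInMeasure_of_tendsto_Lp h1).exists_seq_tendsto_ae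
  refine ⟨fun r => Filter.limUnder Filter.atTop (fun k => f (ns k) r), ?_⟩
  have hall : ∀ᵐ x ∂discMeasure, ∀ n, (p n).1 x = f n ‖x‖ := ae_all_iff.2 hf
  filter_upwards [hns, hall] with x hx h2
  simp only [h2] at hx
  exact hx.limUnder_eq.symm

/-- The underlying subspace of `H¹_{rad,0}(𝔻)`: the radial elements of `H¹₀(𝔻)`. -/
noncomputable def radSubspace : Submodule ℝ (L2Disc × (Fin 2 → L2Disc)) :=
  sobolevZero ⊓ radialPairs

lemma isClosed_radSubspace :
    IsClosed (radSubspace : Set (L2Disc × (Fin 2 → L2Disc))) :=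
  testPairs.isClosed_topologicalClosure.inter isClosed_radialPairs

lemma norm_le_sum_basis (L : Plane →L[ℝ] ℂ) :
    ‖L‖ ≤ ∑ i : Fin 2, ‖L (EuclideanSpace.single i (1 : ℝ))‖ := by
  refine L.opNorm_le_bound (Finset.sum_nonneg fun i _ => norm_nonneg _) fun v => ?_
  have hv : v = ∑ i : Fin 2, v i • EuclideanSpace.single i (1 : ℝ) := by
    ext j; fin_cases j <;> simp [Fin.sum_univ_two]
  calc ‖L v‖ = ‖∑ i : Fin 2, v i • L (EuclideanSpace.single i (1 : ℝ))‖ := by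
        conv_lhs => rw [hv]
        simp only [map_sum, map_smul]
    _ ≤ ∑ i : Fin 2, ‖v i • L (EuclideanSpace.single i (1 : ℝ))‖ := norm_sum_le _ _
    _ ≤ ∑ i : Fin 2, ‖L (EuclideanSpace.single i (1 : ℝ))‖ * ‖v‖ := by
        refine Finset.sum_le_sum fun i _ => ?_
        rw [norm_smul, mul_comm]
        exact mul_le_mul_of_nonneg_left (PiLp.norm_apply_le v i) (norm_nonneg _)
    _ = _ := by rw [Finset.sum_mul]

/-- Poincaré inequality for test functions. -/
lemma poincare_test : ∃ K : ℝ, 0 ≤ K ∧ ∀ p ∈ testPairs,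
    ‖p.1‖ ≤ K * ∑ i, ‖p.2 i‖ := by
  set C := eLpNormLESNormFDerivOfLeConst ℂ (volume : Measure Plane)
    (Metric.ball (0 : Plane) 1) 1 2
  set M : ℝ≥0∞ := discMeasure Set.univ ^ (1 / (1 : ℝ≥0∞).toReal - 1 / (2 : ℝ≥0∞).toReal)
  have hM : M ≠ ⊤ := by
    refine ENNReal.rpow_ne_top_of_nonneg ?_ (measure_ne_top _ _)
    norm_num
  refine ⟨(C * M).toReal, ENNReal.toReal_nonneg, ?_⟩
  rintro p ⟨φ, h1, h2, h3, h4, h5⟩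
  have hsupp : Function.support (fderiv ℝ φ) ⊆ Metric.ball (0 : Plane) 1 :=
    (support_fderiv_subset ℝ).trans h3
  have hcont : Continuous (fderiv ℝ φ) := h1.continuous_fderiv (by simp)
  have e1 : eLpNorm p.1 2 discMeasure ≤ C * eLpNorm (fderiv ℝ φ) 1 volume := by
    rw [eLpNorm_congr_ae h4]
    refine (eLpNorm_mono_measure φ Measure.restrict_le_self).trans ?_
    have := eLpNorm_le_eLpNorm_fderiv_of_le (F := ℂ) (volume : Measure Plane)
      (u := φ) (s := Metric.ball (0 : Plane) 1) (h1.of_le (by simp))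
      ((subset_tsupport φ).trans h3) (p := 1) (q := 2) le_rfl (by simp)
      (by simp; norm_num) Metric.isBounded_ball
    simpa using this
  have e2 : eLpNorm (fderiv ℝ φ) 1 volume ≤ eLpNorm (fderiv ℝ φ) 2 discMeasure * M := by
    have h0 : eLpNorm (fderiv ℝ φ) 1 volume = eLpNorm (fderiv ℝ φ) 1 discMeasure :=
      (eLpNorm_restrict_eq_of_support_subset (f := fderiv ℝ φ) (p := 1) (μ := volume) hsupp).symm
    rw [h0]
    exact eLpNorm_le_eLpNorm_mul_rpow_measure_univ (by norm_num) hcont.aestronglyMeasurable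
  have e3 : eLpNorm (fderiv ℝ φ) 2 discMeasure ≤ ∑ i, eLpNorm (p.2 i) 2 discMeasure := by
    have hc : ∀ i, Continuous (partialDeriv i φ) := fun i =>
      hcont.clm_apply continuous_const
    calc eLpNorm (fderiv ℝ φ) 2 discMeasure
        ≤ eLpNorm (∑ i, fun x => ‖partialDeriv i φ x‖) 2 discMeasure := by
          refine eLpNorm_mono_real fun x => ?_
          simpa [partialDeriv] using norm_le_sum_basis (fderiv ℝ φ x)
      _ ≤ ∑ i, eLpNorm (fun x => ‖partialDeriv i φ x‖) 2 discMeasure :=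
          eLpNorm_sum_le (fun i _ => (hc i).norm.aestronglyMeasurable) (by norm_num)
      _ = _ := by
          refine Finset.sum_congr rfl fun i _ => ?_
          rw [eLpNorm_norm, eLpNorm_congr_ae (h5 i)]
  have e4 : eLpNorm p.1 2 discMeasure ≤ C * M * ∑ i, eLpNorm (p.2 i) 2 discMeasure := by
    calc _ ≤ _ := e1
      _ ≤ C * (eLpNorm (fderiv ℝ φ) 2 discMeasure * M) := by gcongr
      _ ≤ C * ((∑ i, eLpNorm (p.2 i) 2 discMeasure) * M) := by gcongr
      _ = _ := by ring
  have e5 := ENNReal.toReal_mono (ENNReal.mul_ne_top (ENNReal.mul_ne_top ENNReal.coe_ne_top hM)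
    (ENNReal.sum_ne_top.2 fun i _ => Lp.eLpNorm_ne_top (p.2 i))) e4
  rw [ENNReal.toReal_mul, ENNReal.toReal_sum fun i _ => Lp.eLpNorm_ne_top (p.2 i)] at e5
  simpa only [Lp.norm_def] using e5

/-- Poincaré inequality on `H¹₀(𝔻)`. -/
lemma poincare : ∃ K : ℝ, 0 ≤ K ∧ ∀ p ∈ sobolevZero, ‖p.1‖ ≤ K * ∑ i, ‖p.2 i‖ := by
  obtain ⟨K, hK, h⟩ := poincare_test
  refine ⟨K, hK, fun p hp => ?_⟩
  have hcl : IsClosed {p : L2Disc × (Fin 2 → L2Disc) | ‖p.1‖ ≤ K * ∑ i, ‖p.2 i‖} :=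
    isClosed_le (by fun_prop) (by fun_prop)
  exact closure_minimal (fun q hq => h q hq) hcl hp

/-- The space `H¹_{rad,0}(𝔻)` of complex-valued radial functions in `H¹(𝔻)` vanishing on `∂𝔻`.
It carries the `Ḣ¹` inner product below (not the norm of the ambient product). -/
def HRad : Type := radSubspace

namespace HRad

noncomputable instance : AddCommGroup HRad := inferInstanceAs (AddCommGroup radSubspace)

noncomputable instance : Module ℝ HRad := inferInstanceAs (Module ℝ radSubspace)

/-- The underlying `L²` function. -/
noncomputable def toFun (w : HRad) : L2Disc := (w : radSubspace).1.1

/-- The weak partial derivatives. -/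
noncomputable def grad (w : HRad) (i : Fin 2) : L2Disc := (w : radSubspace).1.2 i

lemma toFun_add (v w : HRad) : (v + w).toFun = v.toFun + w.toFun := rfl

lemma toFun_smul (c : ℝ) (w : HRad) : (c • w).toFun = c • w.toFun := rfl

lemma grad_add (v w : HRad) (i : Fin 2) : (v + w).grad i = v.grad i + w.grad i := rfl

lemma grad_smul (c : ℝ) (w : HRad) (i : Fin 2) : (c • w).grad i = c • w.grad i := rfl

lemma ext_grad {w : HRad} (h : ∀ i, w.grad i = 0) : w = 0 := by
  obtain ⟨K, -, hp⟩ := poincare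
  have h0 : ‖w.toFun‖ ≤ K * ∑ i, ‖w.grad i‖ := hp _ (w : radSubspace).2.1
  simp only [h, norm_zero, Finset.sum_const_zero, mul_zero] at h0
  have h1 : w.toFun = 0 := norm_le_zero_iff.1 h0
  exact Subtype.ext (Prod.ext h1 (funext h))

/-- The inner product `⟪v, w⟫ = Re ∫_𝔻 ∇v · conj ∇w`. -/
@[reducible] noncomputable def core : InnerProductSpace.Core ℝ HRad where
  inner v w := ∑ i, ⟪v.grad i, w.grad i⟫_ℝ
  conj_inner_symm v w := by
    simp only [map_sum, conj_trivial]
    exact Finset.sum_congr rfl fun i _ => real_inner_comm _ _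
  re_inner_nonneg v := by
    simp only [RCLike.re_to_real]
    exact Finset.sum_nonneg fun i _ => real_inner_self_nonneg
  add_left u v w := by
    simp only [grad_add, inner_add_left, Finset.sum_add_distrib]
  smul_left v w c := by
    simp only [grad_smul, real_inner_smul_left, Finset.mul_sum, conj_trivial]
  definite v h := by
    refine ext_grad fun i => ?_
    have := (Finset.sum_eq_zero_iff_of_nonneg fun i _ => real_inner_self_nonneg).1 h i
      (Finset.mem_univ i)
    exact inner_self_eq_zero.1 this

noncomputable instance : NormedAddCommGroup HRad := core.toNormedAddCommGroup

noncomputable instance : InnerProductSpace ℝ HRad := InnerProductSpace.ofCore core.toCore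

lemma inner_def (v w : HRad) : ⟪v, w⟫_ℝ = ∑ i, ⟪v.grad i, w.grad i⟫_ℝ := rfl

lemma norm_grad_le (w : HRad) (i : Fin 2) : ‖w.grad i‖ ≤ ‖w‖ := by
  refine le_of_sq_le_sq ?_ (norm_nonneg _)
  rw [← real_inner_self_eq_norm_sq, ← real_inner_self_eq_norm_sq, inner_def]
  exact Finset.single_le_sum (f := fun i => ⟪w.grad i, w.grad i⟫_ℝ)
    (fun i _ => real_inner_self_nonneg) (Finset.mem_univ i)

lemma exists_norm_toFun_le : ∃ K : ℝ, 0 ≤ K ∧ ∀ w : HRad, ‖w.toFun‖ ≤ K * ‖w‖ := by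
  obtain ⟨K, hK, hp⟩ := poincare
  refine ⟨K * 2, by positivity, fun w => ?_⟩
  have h0 : ‖w.toFun‖ ≤ K * ∑ i, ‖w.grad i‖ := hp _ (w : radSubspace).2.1
  have h1 : ∑ i, ‖w.grad i‖ ≤ 2 * ‖w‖ := by
    rw [Fin.sum_univ_two]
    linarith [norm_grad_le w 0, norm_grad_le w 1]
  calc _ ≤ _ := h0
    _ ≤ K * (2 * ‖w‖) := by gcongr
    _ = _ := by ring

/-- The embedding `H¹_{rad,0}(𝔻) → L²(𝔻)`. -/
noncomputable def incl : HRad →L[ℝ] L2Disc :=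
  LinearMap.mkContinuousOfExistsBound
    { toFun := toFun, map_add' := toFun_add, map_smul' := toFun_smul }
    (by obtain ⟨K, -, h⟩ := exists_norm_toFun_le; exact ⟨K, h⟩)

/-- The weak gradient, `H¹_{rad,0}(𝔻) → L²(𝔻)²`. -/
noncomputable def gradL (i : Fin 2) : HRad →L[ℝ] L2Disc :=
  LinearMap.mkContinuous
    { toFun := fun w => w.grad i
      map_add' := fun v w => grad_add v w i
      map_smul' := fun c w => grad_smul c w i } 1
    (fun w => by simpa using norm_grad_le w i)

instance : CompleteSpace HRad := by
  refine Metric.complete_of_cauchySeq_tendsto fun u hu => ?_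
  have c1 : CauchySeq fun n => incl (u n) := hu.map incl.uniformContinuous
  have c2 : ∀ i, CauchySeq fun n => gradL i (u n) := fun i => hu.map (gradL i).uniformContinuous
  obtain ⟨a, ha⟩ := cauchySeq_tendsto_of_complete c1
  choose b hb using fun i => cauchySeq_tendsto_of_complete (c2 i)
  have hlim : Filter.Tendsto (fun n => ((u n).toFun, (u n).grad))
      Filter.atTop (nhds (a, b)) :=
    ha.prodMk_nhds (tendsto_pi_nhds.2 hb)
  have hmem : (a, b) ∈ radSubspace :=
    isClosed_radSubspace.mem_of_tendsto hlim (Filter.Eventually.of_forall fun n =>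
      (show radSubspace from u n).2)
  let w : HRad := (⟨(a, b), hmem⟩ : radSubspace)
  refine ⟨w, ?_⟩
  rw [tendsto_iff_norm_sub_tendsto_zero]
  have hsq : Filter.Tendsto (fun n => ∑ i, ‖gradL i (u n) - b i‖ ^ 2) Filter.atTop (nhds 0) := by
    have : Filter.Tendsto (fun n => ∑ i, ‖gradL i (u n) - b i‖ ^ 2) Filter.atTop
        (nhds (∑ i : Fin 2, (0 : ℝ) ^ 2)) :=
      tendsto_finsetSum _ fun i _ => ((tendsto_iff_norm_sub_tendsto_zero.1 (hb i)).pow 2)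
    simpa using this
  have heq : ∀ n, ‖u n - w‖ = √(∑ i, ‖gradL i (u n) - b i‖ ^ 2) := fun n => by
    rw [eq_comm, Real.sqrt_eq_iff_mul_self_eq (by positivity) (norm_nonneg _),
      ← real_inner_self_eq_norm_mul_norm, inner_def]
    refine Finset.sum_congr rfl fun i _ => ?_
    rw [real_inner_self_eq_norm_sq]
    rfl
  simp only [heq]
  simpa using hsq.sqrt

end HRad

/-- The Dirichlet solution operator `(-Δ)⁻¹ : L²(𝔻) → H¹_{rad,0}(𝔻)`: the adjoint of the embedding,
i.e. `u = (-Δ)⁻¹ f` is the weak solution of `-Δ u = f`, see `inner_invLaplacian`. -/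
noncomputable def invLaplacian : L2Disc →L[ℝ] HRad := ContinuousLinearMap.adjoint HRad.incl

lemma inner_invLaplacian (f : L2Disc) (v : HRad) :
    ⟪invLaplacian f, v⟫_ℝ = ⟪f, HRad.incl v⟫_ℝ :=
  ContinuousLinearMap.adjoint_inner_left _ _ _

/-- `Q` is the ground state: the positive, radial, exponentially decaying smooth solution of
`ΔQ + Q³ - Q = 0` on `ℝ²`. -/
structure IsGroundState (Q : Plane → ℝ) : Prop where
  smooth : ContDiff ℝ ∞ Q
  radial : ∀ x y : Plane, ‖x‖ = ‖y‖ → Q x = Q y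
  pos : ∀ x, 0 < Q x
  decay : ∃ C c : ℝ, 0 < c ∧ ∀ x, Q x ≤ C * Real.exp (-c * ‖x‖)
  equation : ∀ x, (Δ Q) x + Q x ^ 3 - Q x = 0

/-- `Q_δ(x) = δ⁻¹ Q(δ⁻¹ x)`. -/
noncomputable def scaledQ (Q : Plane → ℝ) (δ : ℝ) (x : Plane) : ℝ := δ⁻¹ * Q (δ⁻¹ • x)

/-- `𝐐_δ(x) = Q_δ(x) - Q_δ(1)`, where `Q_δ(1)` is the value of `Q_δ` on the unit circle. -/
noncomputable def boldQ (Q : Plane → ℝ) (δ : ℝ) (x : Plane) : ℝ :=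
  scaledQ Q δ x - scaledQ Q δ (EuclideanSpace.single 0 1)

/-- `∂_δ 𝐐_δ`. -/
noncomputable def derivBoldQ (Q : Plane → ℝ) (δ : ℝ) (x : Plane) : ℝ :=
  deriv (fun d => boldQ Q d x) δ

lemma contDiff_boldQ {Q : Plane → ℝ} (hQ : IsGroundState Q) (δ : ℝ) :
    ContDiff ℝ ∞ (boldQ Q δ) := by
  have h := hQ.smooth
  unfold boldQ scaledQ
  fun_prop

lemma hasDerivAt_scaledQ {Q : Plane → ℝ} (hQ : IsGroundState Q) {δ : ℝ} (hδ : 0 < δ) (x : Plane) :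
    HasDerivAt (fun d => scaledQ Q d x)
      (-(δ ^ 2)⁻¹ * Q (δ⁻¹ • x) + δ⁻¹ * fderiv ℝ Q (δ⁻¹ • x) (-(δ ^ 2)⁻¹ • x)) δ := by
  have h1 : HasDerivAt (fun d : ℝ => d⁻¹) (-(δ ^ 2)⁻¹) δ := hasDerivAt_inv hδ.ne'
  have h2 : HasDerivAt (fun d : ℝ => d⁻¹ • x) (-(δ ^ 2)⁻¹ • x) δ := h1.smul_const x
  have h3 : HasFDerivAt Q (fderiv ℝ Q (δ⁻¹ • x)) (δ⁻¹ • x) :=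
    (hQ.smooth.differentiable (by simp) _).hasFDerivAt
  exact h1.mul (h3.comp_hasDerivAt δ h2)

lemma contDiff_derivBoldQ {Q : Plane → ℝ} (hQ : IsGroundState Q) {δ : ℝ} (hδ : 0 < δ) :
    ContDiff ℝ ∞ (derivBoldQ Q δ) := by
  have h := hQ.smooth
  have h' : ContDiff ℝ ∞ (fderiv ℝ Q) := h.fderiv_right (by simp)
  have he : derivBoldQ Q δ = fun x =>
      (-(δ ^ 2)⁻¹ * Q (δ⁻¹ • x) + δ⁻¹ * fderiv ℝ Q (δ⁻¹ • x) (-(δ ^ 2)⁻¹ • x)) -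
        (-(δ ^ 2)⁻¹ * Q (δ⁻¹ • EuclideanSpace.single 0 1) +
          δ⁻¹ * fderiv ℝ Q (δ⁻¹ • EuclideanSpace.single 0 1)
            (-(δ ^ 2)⁻¹ • EuclideanSpace.single 0 1)) := by
    funext x
    exact ((hasDerivAt_scaledQ hQ hδ x).sub (hasDerivAt_scaledQ hQ hδ _)).deriv
  rw [he]
  fun_prop

lemma continuous_laplacian {f : Plane → ℝ} (hf : ContDiff ℝ ∞ f) : Continuous (Δ f) := by
  rw [InnerProductSpace.laplacian_eq_iteratedFDeriv_stdOrthonormalBasis]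
  have h : Continuous (iteratedFDeriv ℝ 2 f) :=
    (contDiff_infty.1 hf 2).continuous_iteratedFDeriv le_rfl
  exact continuous_finsetSum _ fun i _ =>
    (ContinuousMultilinearMap.apply ℝ (fun _ : Fin 2 => Plane) ℝ _).continuous.comp h

/-- A continuous function on the plane is bounded on the disc, hence lies in every `Lᵖ(𝔻)`. -/
lemma memLp_of_continuous {F : Type} [NormedAddCommGroup F] [SecondCountableTopology F]
    {g : Plane → F} (hg : Continuous g) (p : ℝ≥0∞) : MemLp g p discMeasure := by
  obtain ⟨C, hC⟩ := (isCompact_closedBall (0 : Plane) 1).exists_bound_of_continuousOn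
    hg.continuousOn
  refine MemLp.of_bound hg.aestronglyMeasurable C ?_
  exact (ae_restrict_iff' measurableSet_ball).2
    (Filter.Eventually.of_forall fun x hx => hC x (Metric.ball_subset_closedBall hx))

/-- The restriction to `𝔻` of a continuous function, as an element of `L²(𝔻)`. -/
noncomputable def toL2 (g : Plane → ℂ) (hg : Continuous g) : L2Disc :=
  (memLp_of_continuous hg 2).toLp g

/-- Multiplication on `L²(𝔻)` by (the restriction to `𝔻` of) a continuous function. -/
noncomputable def mulOp (V : Plane → ℝ) (hV : Continuous V) : L2Disc →L[ℝ] L2Disc :=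
  (ContinuousLinearMap.lsmul ℝ ℝ : ℝ →L[ℝ] ℂ →L[ℝ] ℂ).holderL discMeasure ⊤ 2 2
    ((memLp_of_continuous hV ⊤).toLp V)

lemma mulOp_apply (V : Plane → ℝ) (hV : Continuous V) (f : L2Disc) :
    mulOp V hV f =ᵐ[discMeasure] fun x => (V x : ℂ) * f x := by
  have h1 := ContinuousLinearMap.coeFn_holder (r := 2)
    (B := (ContinuousLinearMap.lsmul ℝ ℝ : ℝ →L[ℝ] ℂ →L[ℝ] ℂ))
    ((memLp_of_continuous hV ⊤).toLp V) f
  filter_upwards [h1, (memLp_of_continuous hV ⊤).coeFn_toLp] with x h2 h3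
  refine h2.trans ?_
  rw [h3]
  simp

/-- `-(1 + 5η) κ 𝐐_δ² + δ⁻²/2`. -/
noncomputable def potential (Q : Plane → ℝ) (κ η δ : ℝ) (x : Plane) : ℝ :=
  -((1 + 5 * η) * κ * boldQ Q δ x ^ 2) + (δ ^ 2)⁻¹ / 2

lemma continuous_potential {Q : Plane → ℝ} (hQ : IsGroundState Q) (κ η δ : ℝ) :
    Continuous (potential Q κ η δ) := by
  have h := (contDiff_boldQ hQ δ).continuous
  unfold potential
  fun_prop

/-- `(-Δ)⁻¹ (-(1 + 5η) κ 𝐐_δ² + δ⁻²/2)` on `H¹_{rad,0}(𝔻)`. -/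
noncomputable def schrodingerOp {Q : Plane → ℝ} (hQ : IsGroundState Q) (κ η δ : ℝ) :
    HRad →L[ℝ] HRad :=
  invLaplacian ∘L mulOp (potential Q κ η δ) (continuous_potential hQ κ η δ) ∘L HRad.incl

/-- The map `w ↦ Re w` on `H¹_{rad,0}(𝔻)`, with values in `L²(𝔻; ℝ)`. -/
noncomputable def rePart : HRad →L[ℝ] Lp ℝ 2 discMeasure :=
  Complex.reCLM.compLpL 2 discMeasure ∘L HRad.incl

/-- The map `w ↦ Im w` on `H¹_{rad,0}(𝔻)`, with values in `L²(𝔻; ℝ)`. -/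
noncomputable def imPart : HRad →L[ℝ] Lp ℝ 2 discMeasure :=
  Complex.imCLM.compLpL 2 discMeasure ∘L HRad.incl

/-- The functional `w ↦ ⟨w, g⟩ = Re ∫_𝔻 w * conj g` on `H¹_{rad,0}(𝔻)`. -/
noncomputable def pairing (g : Plane → ℂ) (hg : Continuous g) : HRad →L[ℝ] ℝ :=
  innerSL ℝ (toL2 g hg) ∘L HRad.incl

lemma pairing_apply (g : Plane → ℂ) (hg : Continuous g) (w : HRad) :
    pairing g hg w = (∫ x in Metric.ball (0 : Plane) 1, w.toFun x * (starRingEnd ℂ) (g x)).re := by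
  have h1 : pairing g hg w = ⟪toL2 g hg, w.toFun⟫_ℝ := rfl
  rw [h1, L2.inner_def]
  have h2 : ∀ᵐ x ∂discMeasure, ⟪toL2 g hg x, w.toFun x⟫_ℝ =
      (w.toFun x * (starRingEnd ℂ) (g x)).re := by
    filter_upwards [(memLp_of_continuous hg 2).coeFn_toLp] with x hx
    rw [toL2, hx, Complex.inner, mul_comm]
  rw [integral_congr_ae h2]
  refine integral_re (𝕜 := ℂ) (μ := discMeasure)
    (f := fun x => w.toFun x * (starRingEnd ℂ) (g x)) ?_
  have h3 : MemLp (fun x => (starRingEnd ℂ) (g x)) 2 discMeasure :=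
    memLp_of_continuous (Complex.continuous_conj.comp hg) 2
  exact (Lp.memLp w.toFun).integrable_mul h3

/-- `(-Δ) ∂_δ 𝐐_δ`. -/
noncomputable def negLapDerivBoldQ (Q : Plane → ℝ) (δ : ℝ) (x : Plane) : ℂ :=
  ((-(Δ (derivBoldQ Q δ)) x : ℝ) : ℂ)

/-- `(-Δ) (i 𝐐_δ)`. -/
noncomputable def negLapIBoldQ (Q : Plane → ℝ) (δ : ℝ) (x : Plane) : ℂ :=
  Complex.I * ((-(Δ (boldQ Q δ)) x : ℝ) : ℂ)

lemma continuous_boldQ_complex {Q : Plane → ℝ} (hQ : IsGroundState Q) (δ : ℝ) :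
    Continuous fun x => (boldQ Q δ x : ℂ) :=
  Complex.continuous_ofReal.comp (contDiff_boldQ hQ δ).continuous

lemma continuous_negLapDerivBoldQ {Q : Plane → ℝ} (hQ : IsGroundState Q) {δ : ℝ} (hδ : 0 < δ) :
    Continuous (negLapDerivBoldQ Q δ) :=
  Complex.continuous_ofReal.comp (continuous_laplacian (contDiff_derivBoldQ hQ hδ)).neg

lemma continuous_negLapIBoldQ {Q : Plane → ℝ} (hQ : IsGroundState Q) (δ : ℝ) :
    Continuous (negLapIBoldQ Q δ) :=
  continuous_const.mul
    (Complex.continuous_ofReal.comp (continuous_laplacian (contDiff_boldQ hQ δ)).neg)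

/-- `W_R = {w ∈ H¹_{rad,0}(𝔻) real-valued : ⟨w, (-Δ) ∂_δ 𝐐_δ⟩ = ⟨w, 𝐐_δ⟩ = 0}`. -/
noncomputable def subspaceR {Q : Plane → ℝ} (hQ : IsGroundState Q) {δ : ℝ} (hδ : 0 < δ) :
    Submodule ℝ HRad :=
  imPart.ker ⊓ ((pairing (negLapDerivBoldQ Q δ) (continuous_negLapDerivBoldQ hQ hδ)).ker ⊓
    (pairing (fun x => (boldQ Q δ x : ℂ)) (continuous_boldQ_complex hQ δ)).ker)

/-- `W_I = {w ∈ H¹_{rad,0}(𝔻) purely imaginary-valued : ⟨w, (-Δ) (i 𝐐_δ)⟩ = 0}`. -/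
noncomputable def subspaceI {Q : Plane → ℝ} (hQ : IsGroundState Q) (δ : ℝ) : Submodule ℝ HRad :=
  rePart.ker ⊓ (pairing (negLapIBoldQ Q δ) (continuous_negLapIBoldQ hQ δ)).ker

instance {Q : Plane → ℝ} (hQ : IsGroundState Q) {δ : ℝ} (hδ : 0 < δ) :
    CompleteSpace (subspaceR hQ hδ) :=
  (imPart.isClosed_ker.inter ((ContinuousLinearMap.isClosed_ker _).inter
    (ContinuousLinearMap.isClosed_ker _))).completeSpace_coe

instance {Q : Plane → ℝ} (hQ : IsGroundState Q) (δ : ℝ) : CompleteSpace (subspaceI hQ δ) :=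
  (rePart.isClosed_ker.inter (ContinuousLinearMap.isClosed_ker _)).completeSpace_coe

lemma mem_subspaceR {Q : Plane → ℝ} (hQ : IsGroundState Q) {δ : ℝ} (hδ : 0 < δ) (w : HRad) :
    w ∈ subspaceR hQ hδ ↔ (∀ᵐ x ∂discMeasure, (w.toFun x).im = 0) ∧
      pairing (negLapDerivBoldQ Q δ) (continuous_negLapDerivBoldQ hQ hδ) w = 0 ∧
      pairing (fun x => (boldQ Q δ x : ℂ)) (continuous_boldQ_complex hQ δ) w = 0 := by
  have h : imPart w = 0 ↔ ∀ᵐ x ∂discMeasure, (w.toFun x).im = 0 := by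
    have h1 : imPart w =ᵐ[discMeasure] fun x => (w.toFun x).im :=
      ContinuousLinearMap.coeFn_compLpL Complex.imCLM w.toFun
    rw [Lp.eq_zero_iff_ae_eq_zero]
    constructor
    · intro h2
      filter_upwards [h1, h2] with x h3 h4
      rw [← h3, h4]; rfl
    · intro h2
      filter_upwards [h1, h2] with x h3 h4
      rw [h3, h4]; rfl
  rw [← h]
  rfl

lemma mem_subspaceI {Q : Plane → ℝ} (hQ : IsGroundState Q) (δ : ℝ) (w : HRad) :
    w ∈ subspaceI hQ δ ↔ (∀ᵐ x ∂discMeasure, (w.toFun x).re = 0) ∧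
      pairing (negLapIBoldQ Q δ) (continuous_negLapIBoldQ hQ δ) w = 0 := by
  have h : rePart w = 0 ↔ ∀ᵐ x ∂discMeasure, (w.toFun x).re = 0 := by
    have h1 : rePart w =ᵐ[discMeasure] fun x => (w.toFun x).re :=
      ContinuousLinearMap.coeFn_compLpL Complex.reCLM w.toFun
    rw [Lp.eq_zero_iff_ae_eq_zero]
    constructor
    · intro h2
      filter_upwards [h1, h2] with x h3 h4
      rw [← h3, h4]; rfl
    · intro h2
      filter_upwards [h1, h2] with x h3 h4
      rw [h3, h4]; rfl
  rw [← h]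
  rfl

/-- `A₁ = P_{W_R} (-Δ)⁻¹ (-(1 + 5η) (3/2) 𝐐_δ² + δ⁻²/2) P_{W_R}`, with `P_{W_R}` the
`Ḣ¹`-orthogonal projection. -/
noncomputable def opA₁ {Q : Plane → ℝ} (hQ : IsGroundState Q) (η : ℝ) {δ : ℝ} (hδ : 0 < δ) :
    HRad →L[ℝ] HRad :=
  (subspaceR hQ hδ).starProjection ∘L schrodingerOp hQ (3 / 2) η δ ∘L
    (subspaceR hQ hδ).starProjection

/-- `A₂ = P_{W_I} (-Δ)⁻¹ (-(1 + 5η) (1/2) 𝐐_δ² + δ⁻²/2) P_{W_I}`, with `P_{W_I}` the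
`Ḣ¹`-orthogonal projection. -/
noncomputable def opA₂ {Q : Plane → ℝ} (hQ : IsGroundState Q) (η δ : ℝ) : HRad →L[ℝ] HRad :=
  (subspaceI hQ δ).starProjection ∘L schrodingerOp hQ (1 / 2) η δ ∘L
    (subspaceI hQ δ).starProjection

/-- `l 0 ≥ l 1 ≥ ⋯ > 0` lists all positive eigenvalues of `A`, each repeated according to its
geometric multiplicity (the real dimension of the eigenspace). -/
structure IsPosEigenvalueList (A : HRad →L[ℝ] HRad) (l : ℕ → ℝ) : Prop where
  antitone : Antitone l
  pos : ∀ n, 0 < l n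
  multiplicity : ∀ μ : ℝ, 0 < μ →
    Cardinal.mk {n : ℕ // l n = μ} =
      Module.rank ℝ (Module.End.eigenspace (A : HRad →ₗ[ℝ] HRad) μ)

/-- `l 0 ≤ l 1 ≤ ⋯ < 0` lists all negative eigenvalues of `A`, each repeated according to its
geometric multiplicity (the real dimension of the eigenspace). -/
structure IsNegEigenvalueList (A : HRad →L[ℝ] HRad) (l : ℕ → ℝ) : Prop where
  monotone : Monotone l
  neg : ∀ n, l n < 0
  multiplicity : ∀ μ : ℝ, μ < 0 →
    Cardinal.mk {n : ℕ // l n = μ} =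
      Module.rank ℝ (Module.End.eigenspace (A : HRad →ₗ[ℝ] HRad) μ)

end RadialDisc

/-! Write `V` for the potential and `T = (-Δ)⁻¹ V`. In the `Ḣ¹` inner product `⟪T w, w⟫ = ∫ V |w|²`,
and `H¹_{rad,0}` embeds compactly in `L²`, so the compression `A = P T P` is compact and symmetric.
Both bounds are then min-max statements about this form (`exists_positive_eigenvalue_list`, applied
to `A` and to `-A`). For `λₙ⁺` one needs an `n`-dimensional subspace of `W` on which the form is
large. For `λₙ⁻` one needs fewer than `n` real linear conditions under which the form is not very
negative.

Since `V = δ⁻² (1/2 - (1 + 5η) κ (Q(x/δ) - β)²)`, with `β` the value of `Q` at radius `1/δ`, three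
pointwise facts suffice (`exists_potential_bounds`), with constants uniform in `η` and `δ`: `V ≥ -m
δ⁻²` everywhere, `V ≥ δ⁻²/4` for `|x| ≥ K δ`, and `V ≤ -v δ⁻²` on a shell of radius of order `δ`.
The last one needs `Q > 1` somewhere, because `(1 + 5η) κ` can be arbitrarily close to `1/2`. If `Q
≤ 1`, then `ΔQ = Q - Q³ ≥ 0`, and the maximum principle contradicts the decay of `Q`.

Positive eigenvalues: put about `n` disjoint radial bumps in `1/4 < |x|² < 1`. Each has energy of
order `n` and mass of order `1/n`, so the form is at least a multiple of `δ⁻² n⁻² ‖w‖²` on their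
span. The at most two orthogonality conditions defining `W` cost at most two dimensions. The same
construction in the negative shell shows that there are infinitely many negative eigenvalues
(`exists_subspace_le_form`).

Lower bound for negative eigenvalues: only the disc of radius `K δ` contributes. Cut it into `N`
annuli of width `K δ / N`. A Poincaré inequality for radial functions, uniform down to inner radius
`0` (`HRad.variance_annulus_le`), bounds the mass there by `(K δ / N)² ‖w‖²` once `w` has zero mean
on each annulus. The factor `δ²` cancels the depth `m δ⁻²`, leaving `O(N⁻²)`. For the first two
eigenvalues no mean condition is affordable, and Dirichlet data on the unit circle alone would lose
a factor `log (1/δ)`. Instead the positive part of `V` on `K δ ≤ |x| < L δ` absorbs the mean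
(`HRad.setIntegral_ball_le`, `exists_neg_form_le`). -/

/-- A positive family with finite superlevel sets can be listed in decreasing order. -/
theorem exists_equiv_nat_antitone {J : Type*} [Infinite J] (μ : J → ℝ) (hpos : ∀ j, 0 < μ j)
    (hfin : ∀ t : ℝ, 0 < t → {j | t ≤ μ j}.Finite) : ∃ σ : ℕ ≃ J, Antitone (μ ∘ σ) := by
  classical
  -- Ties are broken by a well-order, so `r` is a strict total order. Each element has finitely many
  -- predecessors because they lie in one superlevel set.
  let r : J → J → Prop := fun i j => μ j < μ i ∨ (μ i = μ j ∧ WellOrderingRel i j)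
  have hfin' : ∀ j, {i | r i j}.Finite := fun j =>
    (hfin (μ j) (hpos j)).subset fun i hi => by
      rcases hi with h | h
      · exact h.le
      · exact h.1.ge
  have htrans : ∀ i j k, r i j → r j k → r i k := by
    rintro i j k (h1 | ⟨h1, h1'⟩) (h2 | ⟨h2, h2'⟩)
    · exact Or.inl (h2.trans h1)
    · exact Or.inl (h2 ▸ h1)
    · exact Or.inl (h1 ▸ h2)
    · exact Or.inr ⟨h1.trans h2, _root_.trans h1' h2'⟩
  have hirr : ∀ i, ¬ r i i := by
    rintro i (h | ⟨-, h⟩)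
    · exact lt_irrefl _ h
    · exact irrefl _ h
  have htri : ∀ i j, r i j ∨ i = j ∨ r j i := by
    intro i j
    rcases lt_trichotomy (μ i) (μ j) with h | h | h
    · exact Or.inr (Or.inr (Or.inl h))
    · rcases trichotomous_of WellOrderingRel i j with h' | h' | h'
      · exact Or.inl (Or.inr ⟨h, h'⟩)
      · exact Or.inr (Or.inl h')
      · exact Or.inr (Or.inr (Or.inr ⟨h.symm, h'⟩))
    · exact Or.inl (Or.inl h)
  let rk : J → ℕ := fun j => {i | r i j}.ncard
  have hmono : ∀ i j, r i j → rk i < rk j := fun i j hij =>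
    Set.ncard_lt_ncard ⟨fun k hk => htrans _ _ _ hk hij, fun h => hirr i (h hij)⟩ (hfin' j)
  have hinj : Function.Injective rk := by
    intro i j hij
    rcases htri i j with h | h | h
    · exact absurd hij (hmono _ _ h).ne
    · exact h
    · exact absurd hij (hmono _ _ h).ne'
  have hanti : ∀ i j, rk i ≤ rk j → μ j ≤ μ i := by
    intro i j hij
    by_contra! h
    exact absurd (hmono j i (Or.inl h)) (not_lt.2 hij)
  -- Counting predecessors embeds `J` in `ℕ` order-preservingly; an infinite subset of `ℕ` is
  -- order-isomorphic to `ℕ`.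
  have hS : Infinite (Set.range rk) := (Equiv.ofInjective rk hinj).infinite_iff.1 inferInstance
  let o := Nat.Subtype.orderIsoOfNat (Set.range rk)
  refine ⟨o.toEquiv.trans (Equiv.ofInjective rk hinj).symm, fun m n hmn => ?_⟩
  refine hanti _ _ ?_
  have key : ∀ k, rk ((Equiv.ofInjective rk hinj).symm (o k)) = (o k : ℕ) := fun k =>
    Equiv.apply_ofInjective_symm hinj (o k)
  change rk ((Equiv.ofInjective rk hinj).symm (o m)) ≤ rk ((Equiv.ofInjective rk hinj).symm (o n))
  rw [key, key]
  exact o.monotone hmn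

/-! ### Diagonalisation and min-max for compact symmetric operators -/

section Spectral

variable {H : Type} [NormedAddCommGroup H] [InnerProductSpace ℝ H]

/-- Parseval in an eigenbasis. Together with `hasSum_norm_sq` it reduces every comparison of the
form with a multiple of `‖w‖²` to a termwise one. -/
theorem hasSum_form {A : H →L[ℝ] H} (hs : (A : H →ₗ[ℝ] H).IsSymmetric)
    {ι : Type} (b : HilbertBasis ι ℝ H) {μ : ι → ℝ} (hb : ∀ i, A (b i) = μ i • b i) (w : H) :
    HasSum (fun i => μ i * ⟪b i, w⟫_ℝ ^ 2) ⟪A w, w⟫_ℝ := by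
  have h := b.hasSum_inner_mul_inner (A w) w
  refine h.congr_fun ?_
  intro i
  have h1 : ⟪A w, b i⟫_ℝ = ⟪w, A (b i)⟫_ℝ := hs w (b i)
  rw [h1, hb, real_inner_smul_right, real_inner_comm]
  ring

theorem hasSum_norm_sq {ι : Type} (b : HilbertBasis ι ℝ H) (w : H) :
    HasSum (fun i => ⟪b i, w⟫_ℝ ^ 2) (‖w‖ ^ 2) := by
  have h := b.hasSum_inner_mul_inner w w
  rw [real_inner_self_eq_norm_sq] at h
  refine h.congr_fun ?_
  intro i
  rw [real_inner_comm (b i) w]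
  ring

/-- Only finitely many eigenvalues of a compact operator lie above a positive level. -/
theorem finite_setOf_le_eigenvalue {A : H →L[ℝ] H} (hc : IsCompactOperator A)
    {ι : Type} (b : HilbertBasis ι ℝ H) {μ : ι → ℝ} (hb : ∀ i, A (b i) = μ i • b i)
    {t : ℝ} (ht : 0 < t) : {i | t ≤ μ i}.Finite := by
  by_contra hinf
  have hinf' : {i | t ≤ μ i}.Infinite := hinf
  let f := hinf'.natEmbedding
  let u : ℕ → H := fun n => A (b (f n))
  have hK : IsCompact (closure (A '' Metric.closedBall 0 1)) :=
    hc.isCompact_closure_image_closedBall 1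
  have hu : ∀ n, u n ∈ closure (A '' Metric.closedBall 0 1) := fun n =>
    subset_closure ⟨b (f n), by simp [b.orthonormal.1], rfl⟩
  obtain ⟨a, -, φ, hφ, hlim⟩ := hK.tendsto_subseq hu
  have hcau := hlim.cauchySeq
  rw [Metric.cauchySeq_iff] at hcau
  obtain ⟨N, hN⟩ := hcau t ht
  have h1 := hN N le_rfl (N + 1) (by omega)
  have hne : (f (φ N) : ι) ≠ f (φ (N + 1)) := fun h =>
    (hφ (Nat.lt_succ_self N)).ne (f.injective (Subtype.ext h))
  -- The images of two distinct basis vectors are orthogonal with lengths at least `t`, so they stay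
  -- a distance `t` apart and no subsequence is Cauchy.
  have h2 : dist ((u ∘ φ) N) ((u ∘ φ) (N + 1)) ^ 2 =
      μ (f (φ N)) ^ 2 + μ (f (φ (N + 1))) ^ 2 := by
    simp only [Function.comp, u, hb, dist_eq_norm]
    rw [norm_sub_sq_real, norm_smul, norm_smul, real_inner_smul_left, real_inner_smul_right,
      b.orthonormal.2 hne, b.orthonormal.1, b.orthonormal.1]
    simp
  have h3 : t ≤ μ (f (φ N)) := (f (φ N)).2
  have h4 : dist ((u ∘ φ) N) ((u ∘ φ) (N + 1)) ^ 2 < t ^ 2 := by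
    gcongr
  nlinarith [sq_nonneg (μ (f (φ (N + 1))))]

variable [CompleteSpace H]

/-- A compact symmetric operator is diagonalised by a Hilbert basis. -/
theorem exists_hilbertBasis_eigenvectors {A : H →L[ℝ] H} (hc : IsCompactOperator A)
    (hs : (A : H →ₗ[ℝ] H).IsSymmetric) :
    ∃ (ι : Type) (b : HilbertBasis ι ℝ H) (μ : ι → ℝ), ∀ i, A (b i) = μ i • b i := by
  have hfam := hs.orthogonalFamily_eigenspaces
  have hcl : ∀ μ : ℝ, CompleteSpace (Module.End.eigenspace (A : H →ₗ[ℝ] H) μ) := fun μ => by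
    have h : IsClosed (Module.End.eigenspace (A : H →ₗ[ℝ] H) μ : Set H) := by
      have : (Module.End.eigenspace (A : H →ₗ[ℝ] H) μ : Set H) = {v | A v = μ • v} := by
        ext v; simp
      rw [this]
      exact isClosed_eq A.continuous (continuous_const_smul μ)
    exact h.completeSpace_coe
  -- The kernel is included and may be infinite-dimensional, hence Hilbert bases in the eigenspaces.
  choose w b hb using fun μ : ℝ =>
    exists_hilbertBasis ℝ (Module.End.eigenspace (A : H →ₗ[ℝ] H) μ)
  let v : (Σ μ : ℝ, w μ) → H := fun a => (b a.1 a.2 : H)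
  have hv : Orthonormal ℝ v :=
    hfam.orthonormal_sigma_orthonormal (v_family := fun μ => b μ) fun μ => (b μ).orthonormal
  have hsp : (Submodule.span ℝ (Set.range v))ᗮ = ⊥ := by
    rw [eq_bot_iff, ← ContinuousLinearMap.orthogonalComplement_iSup_eigenspaces_eq_bot hc hs]
    rw [← Submodule.orthogonal_closure (Submodule.span ℝ (Set.range v))]
    refine Submodule.orthogonal_le (iSup_le fun μ x hx => ?_)
    have h1 : (⟨x, hx⟩ : Module.End.eigenspace (A : H →ₗ[ℝ] H) μ) ∈
        (Submodule.span ℝ (Set.range (b μ))).topologicalClosure := by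
      rw [(b μ).dense_span]; trivial
    have h2 : (Submodule.span ℝ (Set.range (b μ))).topologicalClosure ≤
        ((Submodule.span ℝ (Set.range v)).topologicalClosure.comap
          (Module.End.eigenspace (A : H →ₗ[ℝ] H) μ).subtype) := by
      refine Submodule.topologicalClosure_minimal _ ?_ ?_
      · rw [Submodule.span_le]
        rintro _ ⟨i, rfl⟩
        exact Submodule.le_topologicalClosure _ (Submodule.subset_span ⟨⟨μ, i⟩, rfl⟩)
      · exact (Submodule.isClosed_topologicalClosure _).preimage continuous_subtype_val
    exact h2 h1
  refine ⟨_, HilbertBasis.mkOfOrthogonalEqBot hv hsp, fun a => a.1, fun a => ?_⟩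
  rw [HilbertBasis.coe_mkOfOrthogonalEqBot]
  exact Module.End.mem_eigenspace_iff.1 (b a.1 a.2).2

/-- A subspace of dimension larger than the number of linear conditions contains a nonzero
solution. -/
theorem exists_ne_zero_mem_of_finrank_lt {V G : Type*} [AddCommGroup V] [Module ℝ V]
    [AddCommGroup G] [Module ℝ G] [FiniteDimensional ℝ G] (F : Submodule ℝ V) (f : V →ₗ[ℝ] G)
    (h : Module.finrank ℝ G < Module.finrank ℝ F) : ∃ w ∈ F, w ≠ 0 ∧ f w = 0 := by
  have : FiniteDimensional ℝ F := Module.finite_of_finrank_pos (by omega)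
  have h1 : LinearMap.ker (f ∘ₗ F.subtype) ≠ ⊥ := LinearMap.ker_ne_bot_of_finrank_lt h
  obtain ⟨w, hw, hw0⟩ := Submodule.exists_mem_ne_zero_of_ne_bot h1
  exact ⟨w, w.2, fun h => hw0 (Subtype.ext h), hw⟩

/-- Listing of the positive eigenvalues of a compact symmetric operator, with the min-max bounds. -/
theorem exists_positive_eigenvalue_list {A : H →L[ℝ] H} (hc : IsCompactOperator A)
    (hs : (A : H →ₗ[ℝ] H).IsSymmetric)
    (hpos : ∀ n : ℕ, ∃ F : Submodule ℝ H, n < Module.finrank ℝ F ∧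
      ∀ w ∈ F, w ≠ 0 → 0 < ⟪A w, w⟫_ℝ) :
    ∃ l : ℕ → ℝ, Antitone l ∧ (∀ n, 0 < l n) ∧
      (∀ ν : ℝ, 0 < ν → Cardinal.mk {n : ℕ // l n = ν} =
        Module.rank ℝ (Module.End.eigenspace (A : H →ₗ[ℝ] H) ν)) ∧
      (∀ (n : ℕ) (c : ℝ) (F : Submodule ℝ H), n < Module.finrank ℝ F →
        (∀ w ∈ F, c * ‖w‖ ^ 2 ≤ ⟪A w, w⟫_ℝ) → c ≤ l n) ∧
      (∀ (n : ℕ) (C : ℝ) (G : Type) [AddCommGroup G] [Module ℝ G] [FiniteDimensional ℝ G]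
        (f : H →ₗ[ℝ] G), Module.finrank ℝ G ≤ n →
        (∀ w, f w = 0 → ⟪A w, w⟫_ℝ ≤ C * ‖w‖ ^ 2) → l n ≤ C) := by
  obtain ⟨ι, b, μ, hb⟩ := exists_hilbertBasis_eigenvectors hc hs
  have hfin : ∀ t : ℝ, 0 < t → {i | t ≤ μ i}.Finite := fun t ht =>
    finite_setOf_le_eigenvalue hc b hb ht
  have horth : ∀ (s : Finset ι) (F : Submodule ℝ H), s.card < Module.finrank ℝ F →
      ∃ w ∈ F, w ≠ 0 ∧ ∀ i ∈ s, ⟪b i, w⟫_ℝ = 0 := by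
    intro s F hF
    obtain ⟨w, hwF, hw0, hw⟩ := exists_ne_zero_mem_of_finrank_lt F
      (LinearMap.pi fun i : s => (innerSL ℝ (b i) : H →ₗ[ℝ] ℝ)) (by simpa using hF)
    exact ⟨w, hwF, hw0, fun i hi => congrFun hw ⟨i, hi⟩⟩
  have hbound : ∀ (s : Finset ι) (w : H) (t : ℝ), (∀ i ∈ s, ⟪b i, w⟫_ℝ = 0) →
      (∀ i, i ∉ s → μ i ≤ t) → ⟪A w, w⟫_ℝ ≤ t * ‖w‖ ^ 2 := by
    intro s w t hw ht
    refine hasSum_le (fun i => ?_) (hasSum_form hs b hb w) ((hasSum_norm_sq b w).mul_left t)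
    by_cases hi : i ∈ s
    · simp [hw i hi]
    · exact mul_le_mul_of_nonneg_right (ht i hi) (sq_nonneg _)
  let J := {i // 0 < μ i}
  -- Were there finitely many positive eigenvalues, a larger subspace with positive form would
  -- contain a nonzero vector orthogonal to their eigenvectors, where the form is nonpositive.
  have hJ : Infinite J := by
    by_contra hJ
    rw [not_infinite_iff_finite] at hJ
    have hJ' : {i | 0 < μ i}.Finite := hJ
    obtain ⟨F, hF, hFpos⟩ := hpos hJ'.toFinset.card
    obtain ⟨w, hwF, hw0, hw⟩ := horth _ F hF
    have := hbound _ w 0 hw fun i hi => by simpa using hi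
    have := hFpos w hwF hw0
    linarith
  obtain ⟨σ, hσ⟩ := exists_equiv_nat_antitone (fun j : J => μ j) (fun j => j.2) fun t ht =>
    (hfin t ht).preimage (f := Subtype.val) Subtype.val_injective.injOn
  let e : ℕ → ι := fun n => (σ n : ι)
  have he : Function.Injective e := Subtype.val_injective.comp σ.injective
  have hl : ∀ n, 0 < μ (e n) := fun n => (σ n).2
  have hsurj : ∀ i, 0 < μ i → ∃ n, e n = i := fun i hi =>
    ⟨σ.symm ⟨i, hi⟩, by simp [e]⟩
  refine ⟨fun n => μ (e n), hσ, hl, ?_, ?_, ?_⟩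
  · intro ν hν
    have hE : Module.End.eigenspace (A : H →ₗ[ℝ] H) ν =
        Submodule.span ℝ (Set.range fun n : {n : ℕ // μ (e n) = ν} => b (e n)) := by
      apply le_antisymm
      · intro v hv
        have hv' : A v = ν • v := Module.End.mem_eigenspace_iff.1 hv
        have hz : ∀ i, μ i ≠ ν → ⟪b i, v⟫_ℝ = 0 := by
          intro i hi
          have h1 : ⟪A (b i), v⟫_ℝ = ⟪b i, A v⟫_ℝ := hs (b i) v
          rw [hb, hv', real_inner_smul_left, real_inner_smul_right] at h1
          have h2 : (μ i - ν) * ⟪b i, v⟫_ℝ = 0 := by linarith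
          exact (mul_eq_zero.1 h2).resolve_left (sub_ne_zero.2 hi)
        -- Only basis vectors with eigenvalue exactly `ν` have nonzero coefficients, and there are
        -- finitely many of them. The expansion is thus a finite sum and `v` lies in the algebraic
        -- span.
        have hS := b.hasSum_repr v
        have hfinν : {i | ν ≤ μ i}.Finite := hfin ν hν
        have hsum := hS.unique (hasSum_sum_of_ne_finset_zero (s := hfinν.toFinset) fun i hi => by
          have : μ i ≠ ν := fun h => hi (by simp [h])
          rw [b.repr_apply_apply, hz i this, zero_smul])
        rw [hsum]
        refine Submodule.sum_mem _ fun i _ => ?_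
        by_cases hi : μ i = ν
        · obtain ⟨n, rfl⟩ := hsurj i (hi ▸ hν)
          exact Submodule.smul_mem _ _ (Submodule.subset_span ⟨⟨n, hi⟩, rfl⟩)
        · rw [b.repr_apply_apply, hz i hi, zero_smul]
          exact Submodule.zero_mem _
      · rw [Submodule.span_le]
        rintro _ ⟨⟨n, hn⟩, rfl⟩
        rw [SetLike.mem_coe, Module.End.mem_eigenspace_iff]
        exact (hb (e n)).trans (by rw [hn])
    have hli : LinearIndependent ℝ fun n : {n : ℕ // μ (e n) = ν} => b (e n) :=
      b.orthonormal.linearIndependent.comp _ (he.comp Subtype.val_injective)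
    rw [hE, rank_span hli, Cardinal.mk_range_eq _ hli.injective]
  · intro n c F hF hc
    -- Indices start at `0`: `F` has dimension above `n`, so it meets the orthogonal complement of
    -- the first `n` eigenvectors, where the form is at most `l n ‖w‖²`.
    obtain ⟨w, hwF, hw0, hw⟩ := horth ((Finset.range n).map ⟨e, he⟩) F (by simpa using hF)
    have h1 := hbound _ w (μ (e n)) hw fun i hi => by
      by_cases hi0 : 0 < μ i
      · obtain ⟨m, rfl⟩ := hsurj i hi0
        refine hσ (?_ : n ≤ m)
        by_contra! hmn
        exact hi (Finset.mem_map.2 ⟨m, Finset.mem_range.2 hmn, rfl⟩)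
      · exact (not_lt.1 hi0).trans (hl n).le
    have h2 := (hc w hwF).trans h1
    exact le_of_mul_le_mul_right h2 (by positivity)
  · intro n C G _ _ _ f hG hC
    -- Dually, the first `n + 1` eigenvectors span a space that meets `ker f`, and the form is at
    -- least `l n ‖w‖²` on it.
    let F := Submodule.span ℝ (Set.range fun k : Fin (n + 1) => b (e k))
    have hli : LinearIndependent ℝ fun k : Fin (n + 1) => b (e k) :=
      b.orthonormal.linearIndependent.comp _ (he.comp Fin.val_injective)
    have hF : Module.finrank ℝ F = n + 1 := by
      simpa using finrank_span_eq_card hli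
    obtain ⟨w, hwF, hw0, hw⟩ := exists_ne_zero_mem_of_finrank_lt F f (by omega)
    have hz : ∀ i, (∀ k : Fin (n + 1), e k ≠ i) → ⟪b i, w⟫_ℝ = 0 := by
      intro i hi
      have hle : F ≤ LinearMap.ker (innerSL ℝ (b i) : H →ₗ[ℝ] ℝ) := by
        rw [Submodule.span_le]
        rintro _ ⟨k, rfl⟩
        exact b.orthonormal.2 (hi k).symm
      exact hle hwF
    have h1 : μ (e n) * ‖w‖ ^ 2 ≤ ⟪A w, w⟫_ℝ := by
      refine hasSum_le (fun i => ?_) ((hasSum_norm_sq b w).mul_left _) (hasSum_form hs b hb w)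
      by_cases hi : ∀ k : Fin (n + 1), e k ≠ i
      · simp [hz i hi]
      · push Not at hi
        obtain ⟨k, rfl⟩ := hi
        exact mul_le_mul_of_nonneg_right (hσ (Nat.lt_succ_iff.1 k.2)) (sq_nonneg _)
    exact le_of_mul_le_mul_right (h1.trans (hC w hw)) (by positivity)

end Spectral

/-! ### Polar coordinates and null sets in the plane -/

namespace RadialDisc

/-- Arc length on the unit circle. -/
noncomputable abbrev circleMeasure : Measure (Metric.sphere (0 : Plane) 1) :=
  (volume : Measure Plane).toSphere

lemma volume_real_unit_ball : (volume : Measure Plane).real (Metric.ball 0 1) = Real.pi := by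
  rw [measureReal_def, EuclideanSpace.volume_ball_fin_two]
  simp [Real.pi_nonneg]

lemma circleMeasure_univ : circleMeasure Set.univ = ENNReal.ofReal (2 * Real.pi) := by
  rw [Measure.toSphere_apply_univ, EuclideanSpace.volume_ball_fin_two]
  simp [ENNReal.ofReal_mul]

/-- Integration in polar coordinates. -/
lemma lintegral_polar {f : Plane → ℝ≥0∞} (hf : Measurable f) :
    ∫⁻ x, f x = ∫⁻ θ : Metric.sphere (0 : Plane) 1,
      (∫⁻ r in Set.Ioi (0 : ℝ), ENNReal.ofReal r * f (r • (θ : Plane))) ∂circleMeasure := by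
  have hmp := (volume : Measure Plane).measurePreserving_homeomorphUnitSphereProd
  have hd : Module.finrank ℝ Plane - 1 = 1 := by simp
  rw [hd] at hmp
  have hg : Measurable fun z : Metric.sphere (0 : Plane) 1 × Set.Ioi (0 : ℝ) =>
      f ((z.2 : ℝ) • (z.1 : Plane)) := hf.comp (by fun_prop)
  have h1 : ∫⁻ x, f x = ∫⁻ x : ({0}ᶜ : Set Plane), f x ∂((volume : Measure Plane).comap (↑)) := by
    rw [lintegral_subtype_comap (measurableSet_singleton _).compl, restrict_compl_singleton]
  have h2 : ∫⁻ x : ({0}ᶜ : Set Plane), f x ∂((volume : Measure Plane).comap (↑)) =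
      ∫⁻ z, f ((z.2 : ℝ) • (z.1 : Plane)) ∂(circleMeasure.prod (Measure.volumeIoiPow 1)) := by
    rw [← hmp.lintegral_comp hg]
    refine lintegral_congr fun x => ?_
    congr 1
    have hx : ‖(x : Plane)‖ ≠ 0 := norm_ne_zero_iff.2 x.2
    simp [smul_smul, hx]
  rw [h1, h2, lintegral_prod _ hg.aemeasurable]
  refine lintegral_congr fun θ => ?_
  have hg' : Measurable fun y : Set.Ioi (0 : ℝ) => f ((y : ℝ) • (θ : Plane)) :=
    hg.comp measurable_prodMk_left
  rw [Measure.volumeIoiPow, lintegral_withDensity_eq_lintegral_mul _ (by fun_prop) hg']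
  simp only [Pi.mul_apply, pow_one]
  exact lintegral_subtype_comap measurableSet_Ioi
    (fun r : ℝ => ENNReal.ofReal r * f (r • (θ : Plane)))

/-- Fubini in polar coordinates: the exceptional null set meets almost every circle in a null set of
angles. -/
lemma ae_radius_of_ae {p : Plane → Prop} (h : ∀ᵐ x, p x) :
    ∀ᵐ r ∂(volume.restrict (Set.Ioi (0 : ℝ))), ∀ᵐ (θ : Metric.sphere (0 : Plane) 1) ∂circleMeasure, p (r • (θ : Plane)) := by
  obtain ⟨T, hT, hTm, hT0⟩ := exists_measurable_superset_of_null (ae_iff.1 h)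
  have hm : Measurable (T.indicator (1 : Plane → ℝ≥0∞)) := measurable_one.indicator hTm
  have h1 := lintegral_polar hm
  rw [lintegral_indicator_one hTm, hT0] at h1
  have hm2 : Measurable (Function.uncurry fun (θ : Metric.sphere (0 : Plane) 1) (r : ℝ) =>
      ENNReal.ofReal r * T.indicator (1 : Plane → ℝ≥0∞) (r • (θ : Plane))) :=
    (ENNReal.measurable_ofReal.comp measurable_snd).mul (hm.comp (by fun_prop))
  rw [lintegral_lintegral_swap hm2.aemeasurable] at h1
  have h2 := (lintegral_eq_zero_iff (hm2.comp measurable_swap).lintegral_prod_right').1 h1.symm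
  filter_upwards [h2, ae_restrict_mem measurableSet_Ioi] with r hr hr0
  have h3 := (lintegral_eq_zero_iff (hm2.comp (measurable_id.prodMk measurable_const))).1 hr
  filter_upwards [h3] with θ hθ
  by_contra hp
  have : r • (θ : Plane) ∈ T := hT hp
  simp [this] at hθ
  exact absurd hr0 (not_lt.2 hθ)

/-- A null set of radii sweeps out a null set of the plane; this returns from radii to points. -/
lemma ae_norm_of_ae_radius {g : ℝ → Prop} (h : ∀ᵐ r ∂(volume.restrict (Set.Ioi (0 : ℝ))), g r) :
    ∀ᵐ x : Plane, g ‖x‖ := by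
  obtain ⟨T, hT, hTm, hT0⟩ := exists_measurable_superset_of_null (ae_iff.1 h)
  have hm' : MeasurableSet {x : Plane | ‖x‖ ∈ T} := measurable_norm hTm
  have hm : Measurable ({x : Plane | ‖x‖ ∈ T}.indicator (1 : Plane → ℝ≥0∞)) :=
    measurable_one.indicator hm'
  have h1 := lintegral_polar hm
  rw [lintegral_indicator_one hm'] at h1
  have h2 : ∀ θ : Metric.sphere (0 : Plane) 1, ∫⁻ r in Set.Ioi (0 : ℝ), ENNReal.ofReal r *
      {x : Plane | ‖x‖ ∈ T}.indicator (1 : Plane → ℝ≥0∞) (r • (θ : Plane)) = 0 := by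
    intro θ
    rw [lintegral_eq_zero_iff' ?_]
    · have : ∀ᵐ r ∂(volume.restrict (Set.Ioi (0 : ℝ))), r ∉ T := measure_eq_zero_iff_ae_notMem.1 hT0
      filter_upwards [this, ae_restrict_mem measurableSet_Ioi] with r hr hr0
      have hn : ‖r • (θ : Plane)‖ = r := by
        rw [norm_smul, norm_eq_of_mem_sphere, mul_one, Real.norm_of_nonneg (le_of_lt hr0)]
      have : r • (θ : Plane) ∉ {x : Plane | ‖x‖ ∈ T} := by simpa [hn] using hr
      rw [Set.indicator_of_notMem this]; simp
    · exact ((ENNReal.measurable_ofReal.mul (hm.comp (by fun_prop)))).aemeasurable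
  simp only [h2, lintegral_zero] at h1
  rw [ae_iff]
  exact measure_mono_null (fun x hx => hT hx) h1

/-! ### Oscillation of radial Sobolev functions -/

/-- Cauchy-Schwarz with the weight `t`. -/
lemma sq_integral_le_log_mul {g : ℝ → ℝ} (hg : Continuous g) {r s : ℝ} (hr : 0 < r) (hrs : r < s) :
    (∫ t in r..s, g t) ^ 2 ≤ Real.log (s / r) * ∫ t in r..s, t * g t ^ 2 := by
  have hL : 0 < Real.log (s / r) := Real.log_pos ((one_lt_div hr).2 hrs)
  set L := Real.log (s / r)
  set I := ∫ t in r..s, g t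
  -- The choice of `k` minimises `∫ t (g - k / t)²`; nonnegativity of the minimum is the claim,
  -- since `∫ t⁻¹ = L`.
  set k := I / L
  have hinv : ContinuousOn (fun t : ℝ => t⁻¹) (Set.uIcc r s) := by
    refine continuousOn_inv₀.mono fun t ht => ?_
    rw [Set.uIcc_of_le hrs.le] at ht
    exact (hr.trans_le ht.1).ne'
  have i1 : IntervalIntegrable (fun t => t * g t ^ 2) volume r s :=
    (by fun_prop : Continuous fun t => t * g t ^ 2).intervalIntegrable _ _
  have i2 : IntervalIntegrable (fun t => 2 * k * g t) volume r s :=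
    (by fun_prop : Continuous fun t => 2 * k * g t).intervalIntegrable _ _
  have i3 : IntervalIntegrable (fun t : ℝ => k ^ 2 * t⁻¹) volume r s :=
    (hinv.intervalIntegrable).const_mul _
  have h0 : 0 ≤ ∫ t in r..s, ((t * g t ^ 2 - 2 * k * g t) + k ^ 2 * t⁻¹) := by
    refine intervalIntegral.integral_nonneg hrs.le fun t ht => ?_
    have ht0 : 0 < t := hr.trans_le ht.1
    have : t * g t ^ 2 - 2 * k * g t + k ^ 2 * t⁻¹ = t * (g t - k * t⁻¹) ^ 2 := by
      field_simp; ring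
    rw [this]; positivity
  rw [intervalIntegral.integral_add (i1.sub i2) i3, intervalIntegral.integral_sub i1 i2,
    intervalIntegral.integral_const_mul, intervalIntegral.integral_const_mul,
    integral_inv_of_pos hr (hr.trans hrs)] at h0
  change 0 ≤ (∫ t in r..s, t * g t ^ 2) - 2 * k * I + k ^ 2 * L at h0
  have h1 : k * L = I := div_mul_cancel₀ _ hL.ne'
  have h2 : I ^ 2 = L * (2 * k * I - k ^ 2 * L) := by rw [← h1]; ring
  rw [h2]
  exact mul_le_mul_of_nonneg_left (by linarith) hL.le

lemma norm_sq_apply_le (D : Plane →L[ℝ] ℂ) (θ : Plane) (hθ : ‖θ‖ = 1) :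
    ‖D θ‖ ^ 2 ≤ ∑ i : Fin 2, ‖D (EuclideanSpace.single i (1 : ℝ))‖ ^ 2 := by
  have hv : θ = ∑ i : Fin 2, θ i • EuclideanSpace.single i (1 : ℝ) := by
    ext j; fin_cases j <;> simp [Fin.sum_univ_two]
  have h1 : ‖D θ‖ ≤ ∑ i : Fin 2, |θ i| * ‖D (EuclideanSpace.single i (1 : ℝ))‖ := by
    calc ‖D θ‖ = ‖∑ i : Fin 2, θ i • D (EuclideanSpace.single i (1 : ℝ))‖ := by
          conv_lhs => rw [hv]
          simp only [map_sum, map_smul]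
      _ ≤ ∑ i : Fin 2, ‖θ i • D (EuclideanSpace.single i (1 : ℝ))‖ := norm_sum_le _ _
      _ = _ := by simp only [norm_smul, Real.norm_eq_abs]
  have h2 : ∑ i : Fin 2, |θ i| ^ 2 = 1 := by
    have := EuclideanSpace.norm_sq_eq θ
    rw [hθ] at this
    simpa using this.symm
  calc ‖D θ‖ ^ 2 ≤ (∑ i : Fin 2, |θ i| * ‖D (EuclideanSpace.single i (1 : ℝ))‖) ^ 2 := by gcongr
    _ ≤ (∑ i : Fin 2, |θ i| ^ 2) * ∑ i : Fin 2, ‖D (EuclideanSpace.single i (1 : ℝ))‖ ^ 2 :=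
      Finset.sum_mul_sq_le_sq_mul_sq _ _ _
    _ = _ := by rw [h2, one_mul]

/-- The oscillation of a smooth function along a ray. -/
lemma norm_sub_sq_le_along_ray {φ : Plane → ℂ} (hφ : ContDiff ℝ ∞ φ) (θ : Plane) (hθ : ‖θ‖ = 1)
    {r s : ℝ} (hr : 0 < r) (hrs : r < s) :
    ‖φ (r • θ) - φ (s • θ)‖ ^ 2 ≤
      Real.log (s / r) * ∫ t in r..s, t * ∑ i, ‖partialDeriv i φ (t • θ)‖ ^ 2 := by
  have hcont : Continuous (fderiv ℝ φ) := hφ.continuous_fderiv (by simp)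
  have hγ : ∀ t : ℝ, HasDerivAt (fun t : ℝ => t • θ) θ t := fun t => by
    simpa using (hasDerivAt_id t).smul_const θ
  have hd : ∀ t : ℝ, HasDerivAt (fun t : ℝ => φ (t • θ)) (fderiv ℝ φ (t • θ) θ) t := fun t =>
    ((hφ.differentiable (by simp) _).hasFDerivAt).comp_hasDerivAt t (hγ t)
  have hdc : Continuous fun t : ℝ => fderiv ℝ φ (t • θ) θ := by fun_prop
  have h1 : φ (s • θ) - φ (r • θ) = ∫ t in r..s, fderiv ℝ φ (t • θ) θ :=
    (intervalIntegral.integral_eq_sub_of_hasDerivAt (fun t _ => hd t)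
      (hdc.intervalIntegrable _ _)).symm
  have h2 : ‖φ (r • θ) - φ (s • θ)‖ ≤ ∫ t in r..s, ‖fderiv ℝ φ (t • θ) θ‖ := by
    rw [norm_sub_rev, h1]
    exact intervalIntegral.norm_integral_le_integral_norm hrs.le
  have hpc : ∀ i, Continuous fun t : ℝ => partialDeriv i φ (t • θ) := fun i => by
    unfold partialDeriv; fun_prop
  calc ‖φ (r • θ) - φ (s • θ)‖ ^ 2 ≤ (∫ t in r..s, ‖fderiv ℝ φ (t • θ) θ‖) ^ 2 := by gcongr
    _ ≤ Real.log (s / r) * ∫ t in r..s, t * ‖fderiv ℝ φ (t • θ) θ‖ ^ 2 :=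
      sq_integral_le_log_mul hdc.norm hr hrs
    _ ≤ _ := by
      refine mul_le_mul_of_nonneg_left ?_ (Real.log_nonneg ((one_le_div hr).2 hrs.le))
      refine intervalIntegral.integral_mono_on hrs.le
        ((by fun_prop : Continuous _).intervalIntegrable _ _)
        ((by fun_prop : Continuous _).intervalIntegrable _ _) fun t ht => ?_
      exact mul_le_mul_of_nonneg_left (norm_sq_apply_le _ θ hθ) (hr.trans_le ht.1).le

/-- The annulus `a ≤ ‖x‖ < b`. -/
def annulus (a b : ℝ) : Set Plane := {x | a ≤ ‖x‖ ∧ ‖x‖ < b}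

lemma measurableSet_annulus (a b : ℝ) : MeasurableSet (annulus a b) :=
  (measurableSet_le measurable_const measurable_norm).inter
    (measurableSet_lt measurable_norm measurable_const)

lemma annulus_subset_ball {a b : ℝ} (hb : b ≤ 1) : annulus a b ⊆ Metric.ball (0 : Plane) 1 :=
  fun x hx => by simpa using hx.2.trans_le hb

/-- The Dirichlet energy over a set of an `L²` vector field. -/
noncomputable def energyOn (S : Set Plane) (g : Fin 2 → L2Disc) : ℝ :=
  ∑ i, ∫ x in S, ‖g i x‖ ^ 2 ∂discMeasure

lemma integrable_norm_sq (f : L2Disc) : Integrable (fun x => ‖f x‖ ^ 2) discMeasure :=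
  (Lp.memLp f).integrable_norm_pow (by simp)

/-- Exhibits local mass as the squared norm of a bounded restriction map, which makes local energies
continuous along `L²` limits. -/
lemma setIntegral_norm_sq_eq (f : L2Disc) (S : Set Plane) :
    ∫ x in S, ‖f x‖ ^ 2 ∂discMeasure = ‖LpToLpRestrictCLM Plane ℂ ℝ discMeasure 2 S f‖ ^ 2 := by
  rw [← real_inner_self_eq_norm_sq, L2.inner_def]
  refine integral_congr_ae ?_
  filter_upwards [LpToLpRestrictCLM_coeFn (𝕜 := ℝ) S f] with x hx
  rw [hx, real_inner_self_eq_norm_sq]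

lemma continuous_energyOn (S : Set Plane) : Continuous (energyOn S) := by
  unfold energyOn
  simp only [setIntegral_norm_sq_eq]
  fun_prop

lemma energyOn_mono {S T : Set Plane} (h : S ⊆ T) (g : Fin 2 → L2Disc) :
    energyOn S g ≤ energyOn T g :=
  Finset.sum_le_sum fun _ _ => setIntegral_mono_set (integrable_norm_sq _).integrableOn
    (Filter.Eventually.of_forall fun _ => sq_nonneg _) (Filter.Eventually.of_forall h)

lemma energyOn_nonneg (S : Set Plane) (g : Fin 2 → L2Disc) : 0 ≤ energyOn S g :=
  Finset.sum_nonneg fun _ _ => integral_nonneg fun _ => sq_nonneg _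

lemma ofReal_energyOn {S : Set Plane} (hS : S ⊆ Metric.ball 0 1) (hSm : MeasurableSet S)
    {φ : Plane → ℂ} {g : Fin 2 → L2Disc} (hg : ∀ i, g i =ᵐ[discMeasure] partialDeriv i φ) :
    ENNReal.ofReal (energyOn S g) =
      ∫⁻ x in S, ENNReal.ofReal (∑ i, ‖partialDeriv i φ x‖ ^ 2) := by
  have hr : discMeasure.restrict S = volume.restrict S := by
    rw [discMeasure, Measure.restrict_restrict hSm, Set.inter_eq_left.2 hS]
  have h1 : energyOn S g = ∫ x in S, ∑ i, ‖g i x‖ ^ 2 ∂discMeasure :=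
    (integral_finsetSum _ fun _ _ => (integrable_norm_sq _).integrableOn).symm
  rw [h1, ofReal_integral_eq_lintegral_ofReal
    (integrable_finsetSum _ fun _ _ => (integrable_norm_sq _).integrableOn)
    (Filter.Eventually.of_forall fun _ => Finset.sum_nonneg fun _ _ => sq_nonneg _), ← hr]
  refine lintegral_congr_ae ?_
  have : ∀ᵐ x ∂(discMeasure.restrict S), ∀ i, g i x = partialDeriv i φ x :=
    ae_all_iff.2 fun i => ae_restrict_of_ae (hg i)
  filter_upwards [this] with x hx
  simp only [hx]

/-- The ray estimate integrated over all directions; the weight `t` becomes the polar Jacobian. The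
approximating test functions need not be radial, so only this averaged form survives. -/
lemma lintegral_circle_sub_le {φ : Plane → ℂ} (hφ : ContDiff ℝ ∞ φ) {g : Fin 2 → L2Disc}
    (hg : ∀ i, g i =ᵐ[discMeasure] partialDeriv i φ) {r s : ℝ} (hr : 0 < r) (hrs : r < s)
    (hs : s ≤ 1) :
    ∫⁻ θ, ENNReal.ofReal (‖φ (r • (θ : Plane)) - φ (s • (θ : Plane))‖ ^ 2) ∂circleMeasure ≤
      ENNReal.ofReal (Real.log (s / r) * energyOn (annulus r s) g) := by
  have hcont : Continuous (fderiv ℝ φ) := hφ.continuous_fderiv (by simp)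
  have hpc : ∀ i, Continuous (partialDeriv i φ) := fun i => hcont.clm_apply continuous_const
  have hL : 0 ≤ Real.log (s / r) := Real.log_nonneg ((one_le_div hr).2 hrs.le)
  have hm : Measurable fun x => ENNReal.ofReal (∑ i, ‖partialDeriv i φ x‖ ^ 2) :=
    (ENNReal.continuous_ofReal.comp (by fun_prop)).measurable
  rw [ENNReal.ofReal_mul hL, ofReal_energyOn (annulus_subset_ball hs) (measurableSet_annulus _ _) hg,
    ← lintegral_indicator (measurableSet_annulus _ _),
    lintegral_polar (hm.indicator (measurableSet_annulus _ _)), ← lintegral_const_mul']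
  swap; · exact ENNReal.ofReal_ne_top
  refine lintegral_mono fun θ => ?_
  have hθ : ‖(θ : Plane)‖ = 1 := norm_eq_of_mem_sphere θ
  refine (ENNReal.ofReal_le_ofReal (norm_sub_sq_le_along_ray hφ θ hθ hr hrs)).trans ?_
  rw [ENNReal.ofReal_mul hL]
  gcongr
  have hc : Continuous fun t : ℝ => t * ∑ i, ‖partialDeriv i φ (t • (θ : Plane))‖ ^ 2 := by
    fun_prop
  rw [intervalIntegral.integral_of_le hrs.le, ofReal_integral_eq_lintegral_ofReal
    ((hc.intervalIntegrable r s).1) ?_]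
  · rw [Measure.restrict_congr_set Ioo_ae_eq_Ioc.symm]
    have hsub : Set.Ioo r s ⊆ Set.Ioi 0 := fun t ht => hr.trans ht.1
    refine le_trans ?_ (lintegral_mono_set hsub)
    refine setLIntegral_mono' measurableSet_Ioo fun t ht => ?_
    have ht0 : 0 < t := hr.trans ht.1
    have hmem : t • (θ : Plane) ∈ annulus r s := by
      simp only [annulus, Set.mem_ofPred_eq, norm_smul, hθ, mul_one, Real.norm_of_nonneg ht0.le]
      exact ⟨ht.1.le, ht.2⟩
    rw [Set.indicator_of_mem hmem, ENNReal.ofReal_mul ht0.le]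
  · filter_upwards [ae_restrict_mem measurableSet_Ioc] with t ht
    have ht0 : 0 < t := hr.trans ht.1
    positivity

/-- Oscillation estimate for radial functions in `H¹₀(𝔻)`. -/
theorem HRad.exists_oscillation_le (w : HRad) : ∃ X : Set Plane, (∀ᵐ x ∂discMeasure, x ∈ X) ∧
    (∀ x ∈ X, ∀ y ∈ X, ‖x‖ = ‖y‖ → w.toFun x = w.toFun y) ∧
    ∀ x ∈ X, ∀ y ∈ X, ‖x‖ < ‖y‖ → 2 * Real.pi * ‖w.toFun x - w.toFun y‖ ^ 2 ≤
      Real.log (‖y‖ / ‖x‖) * energyOn (annulus ‖x‖ ‖y‖) w.grad := by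
  obtain ⟨hcl, f, hf⟩ := (w : radSubspace).2
  change ∀ᵐ x ∂discMeasure, w.toFun x = f ‖x‖ at hf
  obtain ⟨p, hp, hlim⟩ := mem_closure_iff_seq_limit.1
    (show (w : radSubspace).1 ∈ closure (testPairs : Set (L2Disc × (Fin 2 → L2Disc))) from hcl)
  choose φ hφ1 hφ2 hφ3 hφ4 hφ5 using hp
  have h1 : Filter.Tendsto (fun n => (p n).1) Filter.atTop (nhds w.toFun) :=
    (continuous_fst.tendsto _).comp hlim
  have h2 : Filter.Tendsto (fun n => (p n).2) Filter.atTop (nhds w.grad) :=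
    (continuous_snd.tendsto _).comp hlim
  obtain ⟨ns, hns, hae⟩ := (tendstoInMeasure_of_tendsto_Lp h1).exists_seq_tendsto_ae
  have hae' : ∀ᵐ x ∂discMeasure, Filter.Tendsto (fun k => φ (ns k) x) Filter.atTop (nhds (f ‖x‖)) := by
    have hall : ∀ᵐ x ∂discMeasure, ∀ n, (p n).1 x = φ n x := ae_all_iff.2 hφ4
    filter_upwards [hae, hf, hall] with x hx h3 h4
    rw [h3] at hx
    simpa only [h4] using hx
  have hae2 : ∀ᵐ x : Plane, x ∈ Metric.ball (0 : Plane) 1 →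
      Filter.Tendsto (fun k => φ (ns k) x) Filter.atTop (nhds (f ‖x‖)) :=
    (ae_restrict_iff' measurableSet_ball).1 hae'
  have hrad : ∀ᵐ r ∂(volume.restrict (Set.Ioi (0 : ℝ))), r < 1 → ∀ᵐ (θ : Metric.sphere (0 : Plane) 1) ∂circleMeasure,
      Filter.Tendsto (fun k => φ (ns k) (r • (θ : Plane))) Filter.atTop (nhds (f r)) := by
    filter_upwards [ae_radius_of_ae hae2, ae_restrict_mem measurableSet_Ioi] with r hr hr0 hr1
    filter_upwards [hr] with θ hθ
    have hn : ‖r • (θ : Plane)‖ = r := by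
      rw [norm_smul, norm_eq_of_mem_sphere, mul_one, Real.norm_of_nonneg (le_of_lt hr0)]
    have := hθ (by simpa [hn] using hr1)
    rwa [hn] at this
  have hG := ae_norm_of_ae_radius hrad
  have hne : ∀ᵐ x : Plane, x ≠ 0 := by simp [ae_iff, measure_singleton]
  -- Besides agreeing with the radial profile, a good point has the test functions converging to
  -- that profile at almost every angle of its circle.
  let X : Set Plane := {x | w.toFun x = f ‖x‖ ∧ x ≠ 0 ∧ ‖x‖ < 1 ∧ (∀ᵐ (θ : Metric.sphere (0 : Plane) 1) ∂circleMeasure,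
      Filter.Tendsto (fun k => φ (ns k) (‖x‖ • (θ : Plane))) Filter.atTop (nhds (f ‖x‖)))}
  refine ⟨X, ?_, ?_, ?_⟩
  · filter_upwards [hf, ae_restrict_of_ae hG, ae_restrict_of_ae hne,
      ae_restrict_mem measurableSet_ball] with x hx1 hx2 hx3 hx4
    have : ‖x‖ < 1 := by simpa using hx4
    exact ⟨hx1, hx3, this, hx2 this⟩
  · rintro x ⟨hx, -⟩ y ⟨hy, -⟩ hxy
    rw [hx, hy, hxy]
  · rintro x ⟨hx1, hx2, hx3, hx4⟩ y ⟨hy1, hy2, hy3, hy4⟩ hxy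
    have hr : 0 < ‖x‖ := norm_pos_iff.2 hx2
    have hL : 0 ≤ Real.log (‖y‖ / ‖x‖) := Real.log_nonneg ((one_le_div hr).2 hxy.le)
    rw [hx1, hy1]
    set r := ‖x‖
    set s := ‖y‖
    -- Fatou on the circle. The limiting integrand is constant in the angle, which produces the
    -- factor `2π`.
    have e1 : ∫⁻ θ, ENNReal.ofReal (‖f r - f s‖ ^ 2) ∂circleMeasure ≤
        Filter.liminf (fun k => ∫⁻ θ, ENNReal.ofReal
          (‖φ (ns k) (r • (θ : Plane)) - φ (ns k) (s • (θ : Plane))‖ ^ 2) ∂circleMeasure)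
          Filter.atTop := by
      refine le_trans (le_of_eq (lintegral_congr_ae ?_)) (lintegral_liminf_le fun k => ?_)
      · filter_upwards [hx4, hy4] with θ h3 h4
        have h5 : Filter.Tendsto (fun k => ENNReal.ofReal
          (‖φ (ns k) (r • (θ : Plane)) - φ (ns k) (s • (θ : Plane))‖ ^ 2)) Filter.atTop
          (nhds (ENNReal.ofReal (‖f r - f s‖ ^ 2))) :=
          ENNReal.tendsto_ofReal ((h3.sub h4).norm.pow 2)
        exact h5.liminf_eq.symm
      · have := (hφ1 (ns k)).continuous
        exact (ENNReal.continuous_ofReal.comp (by fun_prop)).measurable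
    have e2 : Filter.Tendsto (fun k => ENNReal.ofReal (Real.log (s / r) *
        energyOn (annulus r s) (p (ns k)).2)) Filter.atTop
        (nhds (ENNReal.ofReal (Real.log (s / r) * energyOn (annulus r s) w.grad))) :=
      ENNReal.tendsto_ofReal ((((continuous_energyOn _).tendsto _).comp
        (h2.comp hns.tendsto_atTop)).const_mul _)
    have e3 := e1.trans ((Filter.liminf_le_liminf (Filter.Eventually.of_forall fun k =>
      lintegral_circle_sub_le (hφ1 (ns k)) (hφ5 (ns k)) hr hxy hy3.le)).trans e2.liminf_eq.le)
    rw [lintegral_const, circleMeasure_univ, ← ENNReal.ofReal_mul (sq_nonneg _),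
      ENNReal.ofReal_le_ofReal_iff (mul_nonneg hL (energyOn_nonneg _ _))] at e3
    linarith

end RadialDisc

/-! ### Variance inequality and a compactness criterion -/

/-- A double-integral form of the variance inequality. -/
theorem integral_norm_sub_average_sq_le {α : Type*} [MeasurableSpace α] (μ : Measure α)
    [IsFiniteMeasure μ] {u : α → ℂ} (hu : MemLp u 2 μ) {k : α → ℝ} (hk : Integrable k μ)
    (h : ∀ᵐ x ∂μ, ∀ᵐ y ∂μ, ‖u x - u y‖ ^ 2 ≤ k x + k y) :
    ∫ x, ‖u x - ⨍ y, u y ∂μ‖ ^ 2 ∂μ ≤ ∫ x, k x ∂μ := by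
  rcases eq_zero_or_neZero μ with rfl | hμ
  · simp
  set m := ⨍ y, u y ∂μ with hm
  set M := μ.real Set.univ with hM
  have hM0 : 0 < M := by
    rw [hM, measureReal_def]
    exact ENNReal.toReal_pos (by simpa using hμ.out) (measure_ne_top _ _)
  have hv : MemLp (fun x => u x - m) 2 μ := hu.sub (memLp_const m)
  have hv1 : Integrable (fun x => u x - m) μ := hv.integrable (by norm_num)
  have hv2 : Integrable (fun x => ‖u x - m‖ ^ 2) μ := hv.integrable_norm_pow (by simp)
  have hv0 : ∫ x, (u x - m) ∂μ = 0 := integral_sub_average μ u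
  set V := ∫ x, ‖u x - m‖ ^ 2 ∂μ with hV
  -- Integrating the hypothesis in `y` kills the cross term around the mean. A second integration in
  -- `x` gives `2 M V ≤ 2 M ∫ k`.
  have hx : ∀ᵐ x ∂μ, M * ‖u x - m‖ ^ 2 + V ≤ M * k x + ∫ y, k y ∂μ := by
    filter_upwards [h] with x hx
    have e1 : ∫ y, ‖u x - u y‖ ^ 2 ∂μ = M * ‖u x - m‖ ^ 2 + V := by
      have e2 : ∀ y, ‖u x - u y‖ ^ 2 =
          (‖u x - m‖ ^ 2 - 2 * ⟪u x - m, u y - m⟫_ℝ) + ‖u y - m‖ ^ 2 := fun y => by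
        rw [← norm_sub_sq_real]; congr 2; ring
      have e3 : Integrable (fun y => ⟪u x - m, u y - m⟫_ℝ) μ := hv1.const_inner _
      have e5 : Integrable (fun y => ‖u x - m‖ ^ 2 - 2 * ⟪u x - m, u y - m⟫_ℝ) μ :=
        (integrable_const _).sub (e3.const_mul 2)
      simp only [e2]
      rw [integral_add e5 hv2, integral_sub (integrable_const _) (e3.const_mul 2), integral_const_mul,
        integral_inner hv1, hv0]
      simp [hM, hV]
    have e4 : ∫ y, (k x + k y) ∂μ = M * k x + ∫ y, k y ∂μ := by
      rw [integral_add (integrable_const _) hk]; simp [hM]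
    rw [← e1, ← e4]
    refine integral_mono_ae ?_ ((integrable_const _).add hk) hx
    have : MemLp (fun y => u x - u y) 2 μ := (memLp_const (u x)).sub hu
    exact this.integrable_norm_pow (by simp)
  have h1 := integral_mono_ae ((hv2.const_mul M).add (integrable_const V))
    ((hk.const_mul M).add (integrable_const (∫ y, k y ∂μ))) hx
  have h2 : M * V + M * V ≤ M * (∫ y, k y ∂μ) + M * ∫ y, k y ∂μ := by
    simpa only [Pi.add_apply, integral_add (hv2.const_mul M) (integrable_const V),
      integral_add (hk.const_mul M) (integrable_const _), integral_const_mul, integral_const,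
      smul_eq_mul] using h1
  nlinarith

/-- An operator that is small on subspaces of finite codimension is compact. -/
theorem isCompactOperator_of_forall_exists_small_on_ker {H E : Type*} [NormedAddCommGroup H]
    [InnerProductSpace ℝ H] [CompleteSpace H] [NormedAddCommGroup E] [NormedSpace ℝ E]
    [CompleteSpace E] (T : H →L[ℝ] E)
    (h : ∀ ε : ℝ, 0 < ε → ∃ K : Submodule ℝ H, IsClosed (K : Set H) ∧ FiniteDimensional ℝ Kᗮ ∧
      ∀ w ∈ K, ‖T w‖ ≤ ε * ‖w‖) : IsCompactOperator T := by
  have hcl : IsClosed {S : H →L[ℝ] E | IsCompactOperator S} :=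
    isClosed_setOfPred_isCompactOperator
  refine hcl.closure_subset (Metric.mem_closure_iff.2 fun ε hε => ?_)
  obtain ⟨K, hK, hfin, hs⟩ := h (ε / 2) (half_pos hε)
  have : CompleteSpace K := hK.completeSpace_coe
  -- Projecting onto the finite-dimensional `Kᗮ` first gives a finite-rank operator, and the error
  -- is `T` restricted to `K`.
  refine ⟨T ∘L Kᗮ.starProjection, ?_, ?_⟩
  · have h1 : IsCompactOperator (T ∘L Kᗮ.subtypeL) :=
      isCompactOperator_of_locallyCompactSpace_rng _
    exact h1.comp_clm Kᗮ.orthogonalProjectionOnto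
  · have h1 : T - T ∘L Kᗮ.starProjection = T ∘L K.starProjection := by
      ext w
      simp only [sub_apply, ContinuousLinearMap.comp_apply, ← map_sub]
      congr 1
      rw [Submodule.starProjection_orthogonal']
      simp
    rw [dist_eq_norm, h1]
    refine lt_of_le_of_lt (ContinuousLinearMap.opNorm_le_bound _ (half_pos hε).le fun w => ?_)
      (half_lt_self hε)
    refine (hs _ (K.starProjection_apply_mem w)).trans ?_
    gcongr
    exact K.norm_starProjection_apply_le w

/-- The orthogonal complement of the kernel of a map to a finite-dimensional space is
finite-dimensional. -/
theorem finiteDimensional_orthogonal_ker {H G : Type*} [NormedAddCommGroup H]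
    [InnerProductSpace ℝ H] [AddCommGroup G] [Module ℝ G] [FiniteDimensional ℝ G]
    (f : H →ₗ[ℝ] G) : FiniteDimensional ℝ (LinearMap.ker f)ᗮ := by
  refine FiniteDimensional.of_injective (f ∘ₗ (LinearMap.ker f)ᗮ.subtype) ?_
  rw [injective_iff_map_eq_zero]
  intro w hw
  have h1 : (w : H) ∈ LinearMap.ker f ⊓ (LinearMap.ker f)ᗮ := ⟨hw, w.2⟩
  rw [Submodule.inf_orthogonal_eq_bot] at h1
  exact Subtype.ext h1

/-! ### Poincaré inequalities on annuli and the compact embedding -/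

namespace RadialDisc

lemma annulus_eq_diff (a b : ℝ) :
    annulus a b = Metric.ball (0 : Plane) b \ Metric.ball (0 : Plane) a := by
  ext x
  simp [annulus, and_comm]

lemma annulus_zero (b : ℝ) : annulus 0 b = Metric.ball (0 : Plane) b := by
  ext x
  simp [annulus]

lemma annulus_union {a b c : ℝ} (hab : a ≤ b) (hbc : b ≤ c) :
    annulus a b ∪ annulus b c = annulus a c := by
  ext x
  simp only [annulus, Set.mem_union, Set.mem_ofPred_eq]
  constructor
  · rintro (⟨h1, h2⟩ | ⟨h1, h2⟩)
    · exact ⟨h1, h2.trans_le hbc⟩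
    · exact ⟨hab.trans h1, h2⟩
  · rintro ⟨h1, h2⟩
    rcases lt_or_ge ‖x‖ b with h | h
    · exact Or.inl ⟨h1, h⟩
    · exact Or.inr ⟨h, h2⟩

lemma annulus_disjoint (a b c : ℝ) : Disjoint (annulus a b) (annulus b c) :=
  Set.disjoint_left.2 fun _ h1 h2 => absurd h1.2 (not_lt.2 h2.1)

lemma annulus_mono {a b a' b' : ℝ} (ha : a' ≤ a) (hb : b ≤ b') : annulus a b ⊆ annulus a' b' :=
  fun _ hx => ⟨ha.trans hx.1, hx.2.trans_le hb⟩

lemma discMeasure_restrict {S : Set Plane} (hSm : MeasurableSet S)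
    (hS : S ⊆ Metric.ball 0 1) : discMeasure.restrict S = volume.restrict S := by
  rw [discMeasure, Measure.restrict_restrict hSm, Set.inter_eq_left.2 hS]

lemma discMeasure_real_annulus {a b : ℝ} (ha : 0 ≤ a) (hab : a ≤ b) (hb : b ≤ 1) :
    discMeasure.real (annulus a b) = Real.pi * (b ^ 2 - a ^ 2) := by
  have h0 : discMeasure.real (annulus a b) = volume.real (annulus a b) := by
    rw [measureReal_def, measureReal_def, discMeasure,
      Measure.restrict_apply (measurableSet_annulus _ _),
      Set.inter_eq_left.2 (annulus_subset_ball hb)]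
  have hball : ∀ r : ℝ, 0 ≤ r → (volume : Measure Plane).real (Metric.ball 0 r) =
      Real.pi * r ^ 2 := fun r hr => by
    rw [measureReal_def, EuclideanSpace.volume_ball_fin_two]
    simp [ENNReal.toReal_ofReal hr, Real.pi_nonneg]
    ring
  rw [h0, annulus_eq_diff, measureReal_sdiff (Metric.ball_subset_ball hab) measurableSet_ball,
    hball a ha, hball b (ha.trans hab)]
  ring

/-- The Jacobian `r` cancels the singularity, so the integral is proportional to the width even when
the annulus is a disc. -/
lemma integral_annulus_inv_norm {a b : ℝ} (ha : 0 ≤ a) (hab : a ≤ b) (hb : b ≤ 1) :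
    IntegrableOn (fun x : Plane => ‖x‖⁻¹) (annulus a b) discMeasure ∧
    ∫ x in annulus a b, ‖x‖⁻¹ ∂discMeasure = 2 * Real.pi * (b - a) := by
  have hr := discMeasure_restrict (measurableSet_annulus a b) (annulus_subset_ball hb)
  have hd : Module.finrank ℝ Plane - 1 = 1 := by simp
  have hind : ((annulus a b).indicator fun x : Plane => ‖x‖⁻¹) =
      fun x => (Set.Ico a b).indicator (fun r : ℝ => r⁻¹) ‖x‖ := by
    funext x
    by_cases hx : x ∈ annulus a b
    · rw [Set.indicator_of_mem hx, Set.indicator_of_mem (show ‖x‖ ∈ Set.Ico a b from hx)]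
    · rw [Set.indicator_of_notMem hx, Set.indicator_of_notMem (show ‖x‖ ∉ Set.Ico a b from hx)]
  have hrad : Set.EqOn
      (fun y : ℝ => y ^ (Module.finrank ℝ Plane - 1) • (Set.Ico a b).indicator (fun r : ℝ => r⁻¹) y)
      ((Set.Ico a b).indicator fun _ => (1 : ℝ)) (Set.Ioi 0) := by
    intro y hy
    have hy0 : y ≠ 0 := ne_of_gt hy
    by_cases h : y ∈ Set.Ico a b <;> simp [h, hy0]
  have hsub : volume.restrict (Set.Ico a b ∩ Set.Ioi 0) = volume.restrict (Set.Ioo a b) := by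
    refine Measure.restrict_congr_set ?_
    have h1 : (Set.Ico a b ∩ Set.Ioi 0 : Set ℝ) =ᵐ[volume] (Set.Ioo a b ∩ Set.Ioi 0 : Set ℝ) :=
      Ioo_ae_eq_Ico.symm.inter Filter.EventuallyEq.rfl
    have h2 : Set.Ioo a b ∩ Set.Ioi 0 = Set.Ioo a b :=
      Set.inter_eq_left.2 fun x hx => ha.trans_lt hx.1
    rwa [h2] at h1
  constructor
  · rw [IntegrableOn, hr, ← IntegrableOn, ← integrable_indicator_iff (measurableSet_annulus _ _),
      hind, integrable_fun_norm_addHaar, integrableOn_congr_fun hrad measurableSet_Ioi]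
    exact (integrable_indicator_iff measurableSet_Ico).2 (by simp) |>.integrableOn
  · rw [hr, ← integral_indicator (measurableSet_annulus _ _), hind, integral_fun_norm_addHaar,
      setIntegral_congr_fun measurableSet_Ioi hrad, integral_indicator measurableSet_Ico,
      Measure.restrict_restrict measurableSet_Ico, hsub, volume_real_unit_ball]
    simp [Real.volume_real_Ioo_of_le hab]
    ring

lemma energyOn_union {S T : Set Plane} (hd : Disjoint S T) (hT : MeasurableSet T)
    (g : Fin 2 → L2Disc) : energyOn (S ∪ T) g = energyOn S g + energyOn T g := by
  unfold energyOn
  rw [← Finset.sum_add_distrib]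
  exact Finset.sum_congr rfl fun i _ => setIntegral_union hd hT
    (integrable_norm_sq _).integrableOn (integrable_norm_sq _).integrableOn

namespace HRad

lemma integrable_norm_sq (w : HRad) : Integrable (fun x => ‖w.toFun x‖ ^ 2) discMeasure :=
  RadialDisc.integrable_norm_sq _

lemma norm_sq_eq_energyOn (w : HRad) : ‖w‖ ^ 2 = energyOn Set.univ w.grad := by
  rw [← real_inner_self_eq_norm_sq, inner_def]
  refine Finset.sum_congr rfl fun i _ => ?_
  rw [L2.inner_def, Measure.restrict_univ]
  simp only [real_inner_self_eq_norm_sq]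

lemma energyOn_le (w : HRad) (S : Set Plane) : energyOn S w.grad ≤ ‖w‖ ^ 2 := by
  rw [norm_sq_eq_energyOn]
  exact energyOn_mono (Set.subset_univ _) _

lemma norm_toFun_sq (w : HRad) : ‖w.toFun‖ ^ 2 = ∫ x, ‖w.toFun x‖ ^ 2 ∂discMeasure := by
  rw [← real_inner_self_eq_norm_sq, L2.inner_def]
  simp only [real_inner_self_eq_norm_sq]

/-- Poincaré-Wirtinger inequality for radial functions on an annulus. -/
theorem variance_annulus_le (w : HRad) {a b : ℝ} (ha : 0 ≤ a) (hab : a < b) (hb : b ≤ 1) :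
    ∫ x in annulus a b, ‖w.toFun x - ⨍ y in annulus a b, w.toFun y ∂discMeasure‖ ^ 2 ∂discMeasure ≤
      (b - a) ^ 2 * energyOn (annulus a b) w.grad := by
  obtain ⟨X, hX, hX1, hX2⟩ := w.exists_oscillation_le
  set E := energyOn (annulus a b) w.grad with hE
  have hE0 : 0 ≤ E := energyOn_nonneg _ _
  have hpi := Real.pi_pos
  obtain ⟨i1, i2⟩ := integral_annulus_inv_norm ha hab.le hb
  set c := (b - a) * E / (2 * Real.pi) with hc
  have hc0 : 0 ≤ c := by
    have : 0 ≤ b - a := by linarith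
    positivity
  -- The bound really involves only the smaller radius; adding the other term makes it symmetric, as
  -- the variance inequality requires.
  have key : ∀ x ∈ X, ∀ y ∈ X, x ∈ annulus a b → y ∈ annulus a b → ‖x‖ < ‖y‖ →
      ‖w.toFun x - w.toFun y‖ ^ 2 ≤ c * ‖x‖⁻¹ + c * ‖y‖⁻¹ := by
    intro x hx y hy hxA hyA hxy
    have h1 := hX2 x hx y hy hxy
    have h2 : energyOn (annulus ‖x‖ ‖y‖) w.grad ≤ E :=
      energyOn_mono (annulus_mono hxA.1 hyA.2.le) _
    -- This is `log t ≤ t - 1`. At `‖x‖ = 0` both sides vanish by the conventions for division and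
    -- logarithm at zero.
    have h3 : Real.log (‖y‖ / ‖x‖) ≤ (b - a) * ‖x‖⁻¹ := by
      rcases (norm_nonneg x).eq_or_lt with h0 | h0
      · simp [← h0]
      · refine (Real.log_le_sub_one_of_pos (div_pos (h0.trans hxy) h0)).trans ?_
        have : ‖y‖ / ‖x‖ - 1 = (‖y‖ - ‖x‖) * ‖x‖⁻¹ := by field_simp
        rw [this]
        gcongr
        · exact hyA.2.le
        · exact hxA.1
    have h4 : 2 * Real.pi * ‖w.toFun x - w.toFun y‖ ^ 2 ≤ (b - a) * ‖x‖⁻¹ * E :=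
      h1.trans (mul_le_mul h3 h2 (energyOn_nonneg _ _)
        (mul_nonneg (by linarith) (inv_nonneg.2 (norm_nonneg _))))
    have h5 : ‖w.toFun x - w.toFun y‖ ^ 2 ≤ c * ‖x‖⁻¹ := by
      rw [hc, div_mul_eq_mul_div, le_div_iff₀ (by positivity)]
      linarith
    have : 0 ≤ c * ‖y‖⁻¹ := by positivity
    linarith
  have hXA : ∀ᵐ x ∂(discMeasure.restrict (annulus a b)), x ∈ X ∧ x ∈ annulus a b := by
    filter_upwards [ae_restrict_of_ae hX, ae_restrict_mem (measurableSet_annulus a b)] with x h1 h2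
    exact ⟨h1, h2⟩
  have hmain := integral_norm_sub_average_sq_le (discMeasure.restrict (annulus a b))
    ((Lp.memLp w.toFun).restrict _) (i1.const_mul c) (by
      filter_upwards [hXA] with x hx
      filter_upwards [hXA] with y hy
      rcases lt_trichotomy ‖x‖ ‖y‖ with h | h | h
      · exact key x hx.1 y hy.1 hx.2 hy.2 h
      · rw [hX1 x hx.1 y hy.1 h, sub_self, norm_zero, zero_pow two_ne_zero]
        exact add_nonneg (mul_nonneg hc0 (inv_nonneg.2 (norm_nonneg _)))
          (mul_nonneg hc0 (inv_nonneg.2 (norm_nonneg _)))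
      · rw [norm_sub_rev, add_comm]
        exact key y hy.1 x hx.1 hy.2 hx.2 h)
  refine hmain.trans (le_of_eq ?_)
  rw [integral_const_mul, i2, hc]
  field_simp

/-- Integration over an annulus. -/
noncomputable def annulusIntegral (a b : ℝ) : HRad →L[ℝ] ℂ :=
  (innerSL ℂ (indicatorConstLp 2 (measurableSet_annulus a b)
    (measure_ne_top discMeasure _) (1 : ℂ))).restrictScalars ℝ ∘L incl

lemma annulusIntegral_apply (a b : ℝ) (w : HRad) :
    annulusIntegral a b w = ∫ x in annulus a b, w.toFun x ∂discMeasure :=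
  L2.inner_indicatorConstLp_one (𝕜 := ℂ) (measurableSet_annulus a b) (measure_ne_top _ _) w.toFun

lemma setIntegral_annulus_le_of_integral_eq_zero (w : HRad) {a b : ℝ} (ha : 0 ≤ a) (hab : a < b)
    (hb : b ≤ 1) (h : annulusIntegral a b w = 0) :
    ∫ x in annulus a b, ‖w.toFun x‖ ^ 2 ∂discMeasure ≤
      (b - a) ^ 2 * energyOn (annulus a b) w.grad := by
  have h1 := w.variance_annulus_le ha hab hb
  rw [annulusIntegral_apply] at h
  simpa [setAverage_eq, h] using h1

/-- The integrals over `N` concentric annuli of equal width in the disc of radius `R`. -/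
noncomputable def annuliIntegrals (R : ℝ) (N : ℕ) : HRad →L[ℝ] (Fin N → ℂ) :=
  ContinuousLinearMap.pi fun j => annulusIntegral (R * j / N) (R * (j + 1) / N)

/-- On a subspace of codimension `2N`, radial functions are small in `L²` of a disc. -/
theorem setIntegral_ball_le_of_annuliIntegrals_eq_zero (w : HRad) {R : ℝ} (hR : 0 < R)
    (hR1 : R ≤ 1) {N : ℕ} (hN : 0 < N) (h : annuliIntegrals R N w = 0) :
    ∫ x in Metric.ball 0 R, ‖w.toFun x‖ ^ 2 ∂discMeasure ≤ (R / N) ^ 2 * ‖w‖ ^ 2 := by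
  have hN' : (0 : ℝ) < N := by exact_mod_cast hN
  -- Both mass and energy are additive over the annuli, so the disc costs no more than one annulus
  -- of width `R / N`.
  have hstep : ∀ n : ℕ, n ≤ N → ∫ x in annulus 0 (R * n / N), ‖w.toFun x‖ ^ 2 ∂discMeasure ≤
      (R / N) ^ 2 * energyOn (annulus 0 (R * n / N)) w.grad := by
    intro n
    induction n with
    | zero =>
      intro _
      have : annulus 0 0 = ∅ := by simp [annulus_zero]
      simp [this, energyOn]
    | succ n ih =>
      intro hn
      have h1 := ih (by omega)
      have hn' : (n : ℝ) + 1 ≤ N := by exact_mod_cast hn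
      have hlt : R * n / N < R * (n + 1) / N := by gcongr; linarith
      have h0 : 0 ≤ R * n / N := by positivity
      have hle : R * (n + 1) / N ≤ 1 := by
        rw [div_le_one hN']
        nlinarith
      have h2 := w.setIntegral_annulus_le_of_integral_eq_zero h0 hlt hle
        (congrFun h ⟨n, by omega⟩)
      have hw : R * (n + 1) / N - R * n / N = R / N := by ring
      rw [hw] at h2
      have hd := annulus_disjoint 0 (R * n / N) (R * (n + 1) / N)
      push_cast
      rw [← annulus_union h0 hlt.le, energyOn_union hd (measurableSet_annulus _ _),
        setIntegral_union hd (measurableSet_annulus _ _) w.integrable_norm_sq.integrableOn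
          w.integrable_norm_sq.integrableOn]
      linarith
  have h1 := hstep N le_rfl
  have h2 : R * N / N = R := by field_simp
  rw [h2, annulus_zero] at h1
  exact h1.trans (by gcongr; exact w.energyOn_le _)

/-- Zero mean on `N` annuli of the unit disc is a condition of finite codimension, under which the
`L²` norm is at most `‖w‖ / N`. -/
lemma isCompactOperator_incl : IsCompactOperator incl := by
  refine isCompactOperator_of_forall_exists_small_on_ker incl fun ε hε => ?_
  obtain ⟨N, hN⟩ := exists_nat_gt (1 / ε)
  have hN0 : (0 : ℝ) < N := (by positivity : (0 : ℝ) < 1 / ε).trans hN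
  refine ⟨(annuliIntegrals 1 N).ker, (annuliIntegrals 1 N).isClosed_ker,
    finiteDimensional_orthogonal_ker _, fun w hw => ?_⟩
  have h1 := w.setIntegral_ball_le_of_annuliIntegrals_eq_zero one_pos le_rfl
    (by exact_mod_cast hN0) hw
  have h2 : ∫ x in Metric.ball 0 1, ‖w.toFun x‖ ^ 2 ∂discMeasure = ‖incl w‖ ^ 2 := by
    rw [discMeasure_restrict measurableSet_ball subset_rfl]
    exact (norm_toFun_sq w).symm
  rw [h2, ← mul_pow] at h1
  refine (le_of_sq_le_sq h1 (by positivity)).trans ?_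
  gcongr
  rw [div_le_iff₀ hN0]
  rw [div_lt_iff₀ hε] at hN
  linarith

/-- The mass in a disc is controlled by the energy and the mass in a surrounding annulus. -/
theorem setIntegral_ball_le (w : HRad) {R S : ℝ} (hR : 0 < R) (hRS : R < S) (hS : S ≤ 1) :
    (S ^ 2 - R ^ 2) * ∫ x in annulus 0 R, ‖w.toFun x‖ ^ 2 ∂discMeasure ≤
      (2 * (S ^ 2 - R ^ 2) + 4 * R ^ 2) * (S ^ 2 * ‖w‖ ^ 2) +
        4 * R ^ 2 * ∫ x in annulus R S, ‖w.toFun x‖ ^ 2 ∂discMeasure := by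
  -- The mean over the large disc links the two regions: the mass in the outer annulus bounds the
  -- mean, and the mean bounds the mass in the inner disc, each up to variance.
  have hV := w.variance_annulus_le le_rfl (hR.trans hRS) hS
  set m := ⨍ y in annulus 0 S, w.toFun y ∂discMeasure
  have hv2 : Integrable (fun x => ‖w.toFun x - m‖ ^ 2) discMeasure :=
    ((Lp.memLp w.toFun).sub (memLp_const m)).integrable_norm_pow (by simp)
  have hd := annulus_disjoint 0 R S
  rw [← annulus_union hR.le hRS.le, setIntegral_union hd (measurableSet_annulus _ _)
    hv2.integrableOn hv2.integrableOn] at hV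
  set VA := ∫ x in annulus 0 R, ‖w.toFun x - m‖ ^ 2 ∂discMeasure
  set VB := ∫ x in annulus R S, ‖w.toFun x - m‖ ^ 2 ∂discMeasure
  have hVA : 0 ≤ VA := integral_nonneg fun _ => sq_nonneg _
  have hVB : 0 ≤ VB := integral_nonneg fun _ => sq_nonneg _
  have htri : ∀ p q : ℂ, ‖p‖ ^ 2 ≤ 2 * ‖p - q‖ ^ 2 + 2 * ‖q‖ ^ 2 := fun p q => by
    have h1 : ‖p‖ ≤ ‖p - q‖ + ‖q‖ := by simpa using norm_add_le (p - q) q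
    nlinarith [sq_nonneg (‖p - q‖ - ‖q‖), norm_nonneg p, norm_nonneg (p - q), norm_nonneg q]
  have hA : ∫ x in annulus 0 R, ‖w.toFun x‖ ^ 2 ∂discMeasure ≤
      2 * VA + 2 * (Real.pi * R ^ 2) * ‖m‖ ^ 2 := by
    have h1 : ∫ x in annulus 0 R, ‖w.toFun x‖ ^ 2 ∂discMeasure ≤
        ∫ x in annulus 0 R, (2 * ‖w.toFun x - m‖ ^ 2 + 2 * ‖m‖ ^ 2) ∂discMeasure :=
      integral_mono w.integrable_norm_sq.integrableOn
        ((hv2.const_mul 2).integrableOn.add (integrable_const _)) fun x => htri _ _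
    rw [integral_add (hv2.const_mul 2).integrableOn (integrable_const _), integral_const_mul,
      setIntegral_const, discMeasure_real_annulus le_rfl hR.le (hRS.le.trans hS), smul_eq_mul] at h1
    linarith
  have hB : Real.pi * (S ^ 2 - R ^ 2) * ‖m‖ ^ 2 ≤
      2 * VB + 2 * ∫ x in annulus R S, ‖w.toFun x‖ ^ 2 ∂discMeasure := by
    have h1 : ∫ x in annulus R S, ‖m‖ ^ 2 ∂discMeasure ≤
        ∫ x in annulus R S, (2 * ‖w.toFun x - m‖ ^ 2 + 2 * ‖w.toFun x‖ ^ 2) ∂discMeasure :=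
      integral_mono (integrable_const _)
        ((hv2.const_mul 2).integrableOn.add (w.integrable_norm_sq.const_mul 2).integrableOn)
        fun x => by simpa [norm_sub_rev] using htri m (w.toFun x)
    rw [integral_add (hv2.const_mul 2).integrableOn (w.integrable_norm_sq.const_mul 2).integrableOn,
      integral_const_mul, integral_const_mul, setIntegral_const,
      discMeasure_real_annulus hR.le hRS.le hS, smul_eq_mul] at h1
    linarith
  have hE : VA + VB ≤ S ^ 2 * ‖w‖ ^ 2 := by
    refine hV.trans ?_
    rw [sub_zero]
    gcongr
    exact w.energyOn_le _
  have hD : 0 < S ^ 2 - R ^ 2 := by nlinarith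
  have h1 := mul_le_mul_of_nonneg_left hA hD.le
  have h2 := mul_le_mul_of_nonneg_left hB (by positivity : 0 ≤ 2 * R ^ 2)
  have h3 := mul_le_mul_of_nonneg_left hE
    (by nlinarith [sq_nonneg R] : 0 ≤ 2 * (S ^ 2 - R ^ 2) + 4 * R ^ 2)
  nlinarith [mul_nonneg hD.le hVB, mul_nonneg (sq_nonneg R) hVA]

end HRad

/-! ### Radial bumps in thin shells -/

lemma coeFn_toL2 (g : Plane → ℂ) (hg : Continuous g) : toL2 g hg =ᵐ[discMeasure] g :=
  (memLp_of_continuous hg 2).coeFn_toLp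

lemma continuous_partialDeriv {φ : Plane → ℂ} (h : ContDiff ℝ ∞ φ) (i : Fin 2) :
    Continuous (partialDeriv i φ) :=
  (h.continuous_fderiv (by simp)).clm_apply continuous_const

/-- The element of `H¹_{rad,0}(𝔻)` given by a radial test function. -/
noncomputable def HRad.ofTest (φ : Plane → ℂ) (h1 : ContDiff ℝ ∞ φ) (h2 : HasCompactSupport φ)
    (h3 : tsupport φ ⊆ Metric.ball (0 : Plane) 1) (h4 : ∃ f : ℝ → ℂ, ∀ x, φ x = f ‖x‖) : HRad :=
  (⟨(toL2 φ h1.continuous, fun i => toL2 (partialDeriv i φ) (continuous_partialDeriv h1 i)),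
    Submodule.le_topologicalClosure _ ⟨φ, h1, h2, h3, coeFn_toL2 φ h1.continuous,
      fun i => coeFn_toL2 _ (continuous_partialDeriv h1 i)⟩, by
      obtain ⟨f, hf⟩ := h4
      refine ⟨f, ?_⟩
      filter_upwards [(memLp_of_continuous h1.continuous 2).coeFn_toLp] with x hx
      exact hx.trans (hf x)⟩ : radSubspace)

/-- A fixed smooth bump function on the line. -/
noncomputable def lineBump : ContDiffBump (0 : ℝ) := ⟨1 / 2, 1, by norm_num, by norm_num⟩

lemma exists_deriv_lineBump_le : ∃ L : ℝ, 0 < L ∧ ∀ t, |deriv lineBump t| ≤ L := by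
  have hs : HasCompactSupport (deriv lineBump) := lineBump.hasCompactSupport.deriv
  have hc : Continuous (deriv lineBump) :=
    (lineBump.contDiff (n := 1)).continuous_deriv le_rfl
  obtain ⟨L, hL⟩ := hs.exists_bound_of_continuous hc
  exact ⟨max L 1, by positivity, fun t => (hL t).trans (le_max_left _ _)⟩

/-- A bound for the slope of `lineBump`. -/
noncomputable def bumpSlope : ℝ := exists_deriv_lineBump_le.choose

lemma bumpSlope_pos : 0 < bumpSlope := exists_deriv_lineBump_le.choose_spec.1

lemma abs_deriv_lineBump_le (t : ℝ) : |deriv lineBump t| ≤ bumpSlope :=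
  exists_deriv_lineBump_le.choose_spec.2 t

lemma lineBump_eq_zero {t : ℝ} (ht : 1 ≤ |t|) : lineBump t = 0 :=
  lineBump.zero_of_le_dist (by simpa [lineBump] using ht)

lemma deriv_lineBump_eq_zero {t : ℝ} (ht : 1 ≤ |t|) : deriv lineBump t = 0 := by
  have hmin : IsLocalMin lineBump t := by
    refine Filter.Eventually.of_forall fun s => ?_
    rw [lineBump_eq_zero ht]
    exact lineBump.nonneg
  exact hmin.deriv_eq_zero

/-- A bump in a shell: `z` times a bump function of `‖x‖²` around `c` of width `h`. -/
noncomputable def shellBump (z : ℂ) (c h : ℝ) (x : Plane) : ℂ := lineBump ((‖x‖ ^ 2 - c) / h) • z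

section Shell

variable {z : ℂ} {c h : ℝ}

lemma contDiff_shellBump : ContDiff ℝ ∞ (shellBump z c h) := by
  have h1 : ContDiff ℝ ∞ fun x : Plane => (‖x‖ ^ 2 - c) / h :=
    ((contDiff_norm_sq ℝ).sub contDiff_const).div_const h
  exact (lineBump.contDiff.comp h1).smul contDiff_const

lemma shellBump_eq_zero (hh : 0 < h) {x : Plane} (hx : h ≤ |‖x‖ ^ 2 - c|) :
    shellBump z c h x = 0 := by
  have : 1 ≤ |(‖x‖ ^ 2 - c) / h| := by
    rwa [abs_div, abs_of_pos hh, one_le_div hh]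
  rw [shellBump, lineBump_eq_zero this, zero_smul]

lemma partialDeriv_shellBump (i : Fin 2) (x : Plane) :
    partialDeriv i (shellBump z c h) x =
      (deriv lineBump ((‖x‖ ^ 2 - c) / h) * (2 * x i / h)) • z := by
  have h1 : HasFDerivAt (fun x : Plane => (‖x‖ ^ 2 - c) / h)
      (h⁻¹ • (2 • innerSL ℝ x : Plane →L[ℝ] ℝ)) x := by
    simpa [div_eq_inv_mul] using (((hasStrictFDerivAt_norm_sq x).hasFDerivAt.sub_const c).const_mul h⁻¹)
  have h2 : HasDerivAt lineBump (deriv lineBump ((‖x‖ ^ 2 - c) / h)) ((‖x‖ ^ 2 - c) / h) :=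
    ((lineBump.contDiff (n := 1)).differentiable one_ne_zero _).hasDerivAt
  have h3 := (h2.comp_hasFDerivAt x h1).smul_const z
  rw [partialDeriv, HasFDerivAt.fderiv (f := shellBump z c h) h3]
  simp [EuclideanSpace.inner_single_right]
  ring_nf
  simp

lemma partialDeriv_shellBump_eq_zero (hh : 0 < h) {x : Plane} (hx : h ≤ |‖x‖ ^ 2 - c|) (i : Fin 2) :
    partialDeriv i (shellBump z c h) x = 0 := by
  have : 1 ≤ |(‖x‖ ^ 2 - c) / h| := by
    rwa [abs_div, abs_of_pos hh, one_le_div hh]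
  rw [partialDeriv_shellBump, deriv_lineBump_eq_zero this]
  simp

lemma tsupport_shellBump_subset (hh : 0 < h) :
    tsupport (shellBump z c h) ⊆ {x | |‖x‖ ^ 2 - c| ≤ h} := by
  refine closure_minimal (fun x hx => ?_) (isClosed_le (by fun_prop) continuous_const)
  by_contra hx'
  exact hx (shellBump_eq_zero hh (not_le.1 hx').le)

lemma tsupport_shellBump_subset_ball (hh : 0 < h) (hch : c + h < 1) :
    tsupport (shellBump z c h) ⊆ Metric.ball (0 : Plane) 1 := by
  refine (tsupport_shellBump_subset hh).trans fun x hx => ?_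
  have h1 : ‖x‖ ^ 2 - c ≤ h := (abs_le.1 hx).2
  rw [mem_ball_zero_iff]
  nlinarith [norm_nonneg x]

/-- The bump in a shell as an element of `H¹_{rad,0}(𝔻)`. -/
noncomputable def HRad.shell (z : ℂ) (c h : ℝ) (hh : 0 < h) (hch : c + h < 1) : HRad :=
  HRad.ofTest (shellBump z c h) contDiff_shellBump
    (HasCompactSupport.of_support_subset_isCompact (isCompact_closedBall (0 : Plane) 1)
      ((subset_tsupport _).trans ((tsupport_shellBump_subset_ball hh hch).trans
        Metric.ball_subset_closedBall)))
    (tsupport_shellBump_subset_ball hh hch)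
    ⟨fun r => lineBump ((r ^ 2 - c) / h) • z, fun _ => rfl⟩

variable (hh : 0 < h) (hch : c + h < 1)

lemma HRad.shell_toFun :
    (HRad.shell z c h hh hch).toFun =ᵐ[discMeasure] shellBump z c h :=
  coeFn_toL2 (shellBump z c h) contDiff_shellBump.continuous

lemma HRad.shell_grad (i : Fin 2) :
    (HRad.shell z c h hh hch).grad i =ᵐ[discMeasure] partialDeriv i (shellBump z c h) :=
  coeFn_toL2 _ (continuous_partialDeriv contDiff_shellBump i)

lemma HRad.inner_shell_eq_zero {c' : ℝ} (hch' : c' + h < 1) (hd : 2 * h ≤ |c - c'|) :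
    ⟪HRad.shell z c h hh hch, HRad.shell z c' h hh hch'⟫_ℝ = 0 := by
  rw [HRad.inner_def]
  refine Finset.sum_eq_zero fun i _ => ?_
  rw [L2.inner_def]
  refine integral_eq_zero_of_ae ?_
  filter_upwards [HRad.shell_grad (z := z) hh hch i, HRad.shell_grad (z := z) hh hch' i]
    with x h1 h2
  rw [h1, h2]
  rcases le_or_gt h |‖x‖ ^ 2 - c| with h3 | h3
  · simp [partialDeriv_shellBump_eq_zero hh h3]
  · have h4 : h ≤ |‖x‖ ^ 2 - c'| := by
      have := abs_sub_le c (‖x‖ ^ 2) c'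
      rw [abs_sub_comm c (‖x‖ ^ 2)] at this
      linarith
    simp [partialDeriv_shellBump_eq_zero hh h4]

/-- The gradient is at most of order `1 / h`. Measuring the shell in `‖x‖²` makes its area `2πh`
whatever the centre `c`. -/
lemma HRad.norm_shell_sq_le (hz : ‖z‖ = 1) (hc : h ≤ c) :
    ‖HRad.shell z c h hh hch‖ ^ 2 ≤ 8 * Real.pi * bumpSlope ^ 2 / h := by
  have hL := bumpSlope_pos
  set S := annulus (√(c - h)) (√(c + h)) with hS
  have hSm : MeasurableSet S := measurableSet_annulus _ _
  have hvol : discMeasure.real S = Real.pi * (2 * h) := by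
    rw [hS, discMeasure_real_annulus (Real.sqrt_nonneg _) (Real.sqrt_le_sqrt (by linarith))
      (Real.sqrt_le_one.2 (by linarith)), Real.sq_sqrt (by linarith),
      Real.sq_sqrt (by linarith)]
    ring
  have hkey : ∀ᵐ x ∂discMeasure, ∑ i, ‖(HRad.shell z c h hh hch).grad i x‖ ^ 2 ≤
      S.indicator (fun _ => 4 * bumpSlope ^ 2 / h ^ 2) x := by
    have hall : ∀ᵐ x ∂discMeasure, ∀ i, (HRad.shell z c h hh hch).grad i x =
        partialDeriv i (shellBump z c h) x := ae_all_iff.2 (HRad.shell_grad hh hch)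
    filter_upwards [hall, ae_restrict_mem measurableSet_ball] with x hx hx1
    simp only [hx]
    rw [mem_ball_zero_iff] at hx1
    by_cases hxS : x ∈ S
    · rw [Set.indicator_of_mem hxS]
      simp only [partialDeriv_shellBump, norm_smul, hz, mul_one, Real.norm_eq_abs, sq_abs]
      have h1 : ∑ i : Fin 2, x i ^ 2 ≤ 1 := by
        have h2 := EuclideanSpace.norm_sq_eq x
        simp only [Real.norm_eq_abs, sq_abs] at h2
        rw [← h2]
        exact pow_le_one₀ (norm_nonneg _) hx1.le
      have h2 : deriv lineBump ((‖x‖ ^ 2 - c) / h) ^ 2 ≤ bumpSlope ^ 2 := by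
        rw [← sq_abs]
        gcongr
        exact abs_deriv_lineBump_le _
      calc ∑ i : Fin 2, (deriv lineBump ((‖x‖ ^ 2 - c) / h) * (2 * x i / h)) ^ 2
          = deriv lineBump ((‖x‖ ^ 2 - c) / h) ^ 2 * (4 / h ^ 2 * ∑ i : Fin 2, x i ^ 2) := by
            rw [Finset.mul_sum, Finset.mul_sum]
            refine Finset.sum_congr rfl fun i _ => ?_
            ring
        _ ≤ bumpSlope ^ 2 * (4 / h ^ 2 * 1) := by gcongr
        _ = _ := by ring
    · rw [Set.indicator_of_notMem hxS]
      have h1 : h ≤ |‖x‖ ^ 2 - c| := by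
        by_contra! hlt
        rw [abs_lt] at hlt
        refine hxS ⟨?_, ?_⟩
        · rw [Real.sqrt_le_left (norm_nonneg _)]; linarith
        · rw [Real.lt_sqrt (norm_nonneg _)]; linarith
      simp [partialDeriv_shellBump_eq_zero hh h1]
  rw [HRad.norm_sq_eq_energyOn, energyOn, ← integral_finsetSum _ fun i _ =>
    (RadialDisc.integrable_norm_sq _).integrableOn, Measure.restrict_univ]
  refine (integral_mono_ae (integrable_finsetSum _ fun i _ => RadialDisc.integrable_norm_sq _)
    ((integrable_const _).indicator hSm) hkey).trans ?_
  rw [integral_indicator hSm, setIntegral_const, hvol, smul_eq_mul]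
  refine le_of_eq ?_
  field_simp
  ring

/-- The bump has modulus one on the half-width shell, whose area is `πh`. -/
lemma HRad.le_integral_shell_sq (hz : ‖z‖ = 1) (hc : h ≤ c) :
    Real.pi * h ≤ ∫ x, ‖(HRad.shell z c h hh hch).toFun x‖ ^ 2 ∂discMeasure := by
  set S := annulus (√(c - h / 2)) (√(c + h / 2)) with hS
  have hSm : MeasurableSet S := measurableSet_annulus _ _
  have hvol : discMeasure.real S = Real.pi * h := by
    rw [hS, discMeasure_real_annulus (Real.sqrt_nonneg _) (Real.sqrt_le_sqrt (by linarith))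
      (Real.sqrt_le_one.2 (by linarith)), Real.sq_sqrt (by linarith),
      Real.sq_sqrt (by linarith)]
    ring
  have hkey : ∀ᵐ x ∂discMeasure, S.indicator (fun _ => (1 : ℝ)) x ≤
      ‖(HRad.shell z c h hh hch).toFun x‖ ^ 2 := by
    filter_upwards [HRad.shell_toFun (z := z) hh hch] with x hx
    by_cases hxS : x ∈ S
    · rw [Set.indicator_of_mem hxS, hx, shellBump]
      have h1 : c - h / 2 ≤ ‖x‖ ^ 2 := (Real.sqrt_le_left (norm_nonneg _)).1 hxS.1
      have h2 : ‖x‖ ^ 2 < c + h / 2 := (Real.lt_sqrt (norm_nonneg _)).1 hxS.2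
      have h3 : lineBump ((‖x‖ ^ 2 - c) / h) = 1 := by
        refine lineBump.one_of_mem_closedBall ?_
        rw [mem_closedBall_zero_iff, Real.norm_eq_abs, abs_div, abs_of_pos hh, div_le_iff₀ hh,
          abs_le]
        simp only [lineBump]
        constructor <;> linarith
      simp [h3, hz]
    · rw [Set.indicator_of_notMem hxS]; positivity
  have h1 := integral_mono_ae ((integrable_const _).indicator hSm)
    (HRad.integrable_norm_sq _) hkey
  rwa [integral_indicator hSm, setIntegral_const, hvol, smul_eq_mul, mul_one] at h1

end Shell

/-! ### The form of `(-Δ)⁻¹ V` and subspaces where it has a sign -/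

/-- Multiplication by a potential followed by the Dirichlet solution operator. -/
noncomputable def potentialOp (V : Plane → ℝ) (hV : Continuous V) : HRad →L[ℝ] HRad :=
  invLaplacian ∘L mulOp V hV ∘L HRad.incl

section PotentialOp

variable {V : Plane → ℝ} (hV : Continuous V)

lemma inner_potentialOp (v w : HRad) :
    ⟪potentialOp V hV v, w⟫_ℝ = ∫ x, V x * ⟪v.toFun x, w.toFun x⟫_ℝ ∂discMeasure := by
  have h1 : ⟪potentialOp V hV v, w⟫_ℝ = ⟪mulOp V hV v.toFun, w.toFun⟫_ℝ :=
    inner_invLaplacian _ _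
  rw [h1, L2.inner_def]
  refine integral_congr_ae ?_
  filter_upwards [mulOp_apply V hV v.toFun] with x hx
  rw [hx, ← Complex.real_smul, real_inner_smul_left]

lemma inner_potentialOp_self (w : HRad) :
    ⟪potentialOp V hV w, w⟫_ℝ = ∫ x, V x * ‖w.toFun x‖ ^ 2 ∂discMeasure := by
  rw [inner_potentialOp]
  simp only [real_inner_self_eq_norm_sq]

lemma isSymmetric_potentialOp : (potentialOp V hV : HRad →ₗ[ℝ] HRad).IsSymmetric := by
  intro v w
  change ⟪potentialOp V hV v, w⟫_ℝ = ⟪v, potentialOp V hV w⟫_ℝ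
  rw [inner_potentialOp, real_inner_comm, inner_potentialOp]
  simp only [real_inner_comm]

lemma isCompactOperator_potentialOp : IsCompactOperator (potentialOp V hV) :=
  HRad.isCompactOperator_incl.clm_comp (invLaplacian ∘L mulOp V hV)

lemma integrable_mul_norm_sq (hV : Continuous V) (w : HRad) :
    Integrable (fun x => V x * ‖w.toFun x‖ ^ 2) discMeasure := by
  have h1 : Integrable (fun x => ⟪mulOp V hV w.toFun x, w.toFun x⟫_ℝ) discMeasure :=
    L2.integrable_inner _ _
  refine h1.congr ?_
  filter_upwards [mulOp_apply V hV w.toFun] with x hx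
  rw [hx, ← Complex.real_smul, real_inner_smul_left, real_inner_self_eq_norm_sq]

end PotentialOp

/-- Applied both to the identity and to `potentialOp`: each is diagonal on disjoint bumps, so one
bump decides the comparison. -/
lemma inner_sum_smul_of_orthogonal {H : Type*} [NormedAddCommGroup H] [InnerProductSpace ℝ H]
    (T : H →L[ℝ] H) {ι : Type*} [Fintype ι] (e : ι → H)
    (ho : ∀ i j, i ≠ j → ⟪T (e i), e j⟫_ℝ = 0) (a : ι → ℝ) :
    ⟪T (∑ i, a i • e i), ∑ i, a i • e i⟫_ℝ = ∑ i, a i ^ 2 * ⟪T (e i), e i⟫_ℝ := by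
  simp only [map_sum, map_smul, sum_inner, inner_sum, real_inner_smul_left, real_inner_smul_right]
  refine Finset.sum_congr rfl fun i _ => ?_
  rw [Finset.sum_eq_single i (fun j _ hji => by rw [ho j i hji]; ring) (by simp)]
  ring

/-- Where the potential has a sign, there are large subspaces on which the form has that sign. -/
theorem exists_subspace_le_form {V : Plane → ℝ} (hV : Continuous V) {σ v a b : ℝ}
    (hv : 0 < v) (ha : 0 ≤ a) (hab : a < b) (hb : b ≤ 1)
    (hsign : ∀ x : Plane, a < ‖x‖ ^ 2 → ‖x‖ ^ 2 < b → v ≤ σ * V x)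
    {z : ℂ} (hz : ‖z‖ = 1) {G : Type} [AddCommGroup G] [Module ℝ G] [FiniteDimensional ℝ G]
    (f : HRad →ₗ[ℝ] G) (n : ℕ) :
    ∃ F : Submodule ℝ HRad, n < Module.finrank ℝ F ∧
      (∀ w ∈ F, f w = 0 ∧ ∀ᵐ x ∂discMeasure, ∃ t : ℝ, w.toFun x = t • z) ∧
      ∀ w ∈ F, v * (b - a) ^ 2 / (128 * bumpSlope ^ 2 * (n + 1 + Module.finrank ℝ G : ℕ) ^ 2) *
        ‖w‖ ^ 2 ≤ σ * ⟪potentialOp V hV w, w⟫_ℝ := by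
  have hL := bumpSlope_pos
  -- The extra `finrank G` bumps pay for the constraint `f = 0`.
  set N := n + 1 + Module.finrank ℝ G with hN
  have hN0 : (0 : ℝ) < (N : ℝ) := by positivity
  -- Each bump occupies the middle half of a slot of length `4h` in the variable `‖x‖²`. Supports
  -- are disjoint and stay inside the open disc even for `b = 1`.
  set h := (b - a) / (4 * N) with hh'
  have hh : 0 < h := div_pos (by linarith) (by positivity)
  have hhN : 4 * N * h = b - a := by rw [hh']; field_simp
  let c : Fin N → ℝ := fun j => a + (4 * (j : ℕ) + 2) * h
  have hcu : ∀ j, c j + h < b := fun j => by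
    have : ((j : ℕ) : ℝ) + 1 ≤ N := by exact_mod_cast j.2
    simp only [c]
    nlinarith
  have hcl : ∀ j, a < c j - h := fun j => by
    have : (0 : ℝ) ≤ ((j : ℕ) : ℝ) * h := by positivity
    simp only [c]
    nlinarith
  have hc1 : ∀ j, c j + h < 1 := fun j => (hcu j).trans_le hb
  have hsep : ∀ i j, i ≠ j → 2 * h ≤ |c i - c j| := fun i j hij => by
    have h1 : c i - c j = 4 * h * (((i : ℕ) : ℝ) - ((j : ℕ) : ℝ)) := by simp only [c]; ring
    have h2 : (1 : ℝ) ≤ |((i : ℕ) : ℝ) - ((j : ℕ) : ℝ)| := by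
      have h3 : ((i : ℕ) : ℤ) - ((j : ℕ) : ℤ) ≠ 0 := by
        intro h; exact hij (Fin.ext (by omega))
      exact_mod_cast Int.one_le_abs h3
    rw [h1, abs_mul, abs_of_pos (by positivity)]
    nlinarith
  let e : Fin N → HRad := fun j => HRad.shell z (c j) h hh (hc1 j)
  have he0 : ∀ i j, i ≠ j → ⟪e i, e j⟫_ℝ = 0 := fun i j hij =>
    HRad.inner_shell_eq_zero hh (hc1 i) (hc1 j) (hsep i j hij)
  have heT : ∀ i j, i ≠ j → ⟪potentialOp V hV (e i), e j⟫_ℝ = 0 := fun i j hij => by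
    rw [inner_potentialOp]
    refine integral_eq_zero_of_ae ?_
    filter_upwards [HRad.shell_toFun (z := z) hh (hc1 i), HRad.shell_toFun (z := z) hh (hc1 j)]
      with x h1 h2
    simp only [e]
    rw [h1, h2]
    rcases le_or_gt h |‖x‖ ^ 2 - c i| with h3 | h3
    · simp [shellBump_eq_zero hh h3]
    · have h4 : h ≤ |‖x‖ ^ 2 - c j| := by
        have h5 := abs_sub_le (c i) (‖x‖ ^ 2) (c j)
        rw [abs_sub_comm (c i) (‖x‖ ^ 2)] at h5
        linarith [hsep i j hij]
      simp [shellBump_eq_zero hh h4]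
  have hmass : ∀ j, v * (Real.pi * h) ≤ σ * ⟪potentialOp V hV (e j), e j⟫_ℝ := fun j => by
    rw [inner_potentialOp_self, ← integral_const_mul]
    refine (mul_le_mul_of_nonneg_left (HRad.le_integral_shell_sq hh (hc1 j) hz
      (by linarith [hcl j])) hv.le).trans ?_
    rw [← integral_const_mul]
    refine integral_mono_ae ((HRad.integrable_norm_sq _).const_mul v)
      ((integrable_mul_norm_sq hV _).const_mul σ) ?_
    filter_upwards [HRad.shell_toFun (z := z) hh (hc1 j)] with x hx
    simp only [e]
    rw [hx, ← mul_assoc]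
    rcases le_or_gt h |‖x‖ ^ 2 - c j| with h3 | h3
    · simp [shellBump_eq_zero hh h3]
    · rw [abs_lt] at h3
      refine mul_le_mul_of_nonneg_right (hsign x ?_ ?_) (sq_nonneg _)
      · linarith [hcl j]
      · linarith [hcu j]
  -- The ratio of `v π h` to `8 π bumpSlope² / h` is `v h² / (8 bumpSlope²)`; inserting `h = (b - a)
  -- / (4N)` gives the factor `128`.
  have hform : ∀ j, v * (b - a) ^ 2 / (128 * bumpSlope ^ 2 * (N : ℝ) ^ 2) * ⟪e j, e j⟫_ℝ ≤
      σ * ⟪potentialOp V hV (e j), e j⟫_ℝ := fun j => by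
    refine le_trans ?_ (hmass j)
    rw [real_inner_self_eq_norm_sq]
    refine (mul_le_mul_of_nonneg_left (HRad.norm_shell_sq_le hh (hc1 j) hz
      (by linarith [hcl j])) (by positivity)).trans (le_of_eq ?_)
    rw [← hhN]
    field_simp
    ring
  have hne : ∀ j, e j ≠ 0 := fun j h0 => by
    have h1 := hmass j
    rw [h0] at h1
    simp only [map_zero, inner_zero_left, mul_zero] at h1
    have : 0 < v * (Real.pi * h) := by positivity
    linarith
  have hli : LinearIndependent ℝ e := linearIndependent_of_ne_zero_of_inner_eq_zero hne he0
  let Φ : (Fin N → ℝ) →ₗ[ℝ] HRad := Fintype.linearCombination ℝ e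
  have hΦ : ∀ t, Φ t = ∑ j, t j • e j := fun t => Fintype.linearCombination_apply ℝ e t
  have hinj : Function.Injective Φ := linearIndependent_iff_injective_fintypeLinearCombination.1 hli
  -- By rank-nullity the combinations killed by `f` have dimension at least `N - finrank G = n + 1`.
  refine ⟨(LinearMap.ker (f ∘ₗ Φ)).map Φ, ?_, ?_, ?_⟩
  · rw [← (Submodule.equivMapOfInjective Φ hinj _).finrank_eq]
    have h1 := LinearMap.finrank_range_add_finrank_ker (f ∘ₗ Φ)
    have h2 := Submodule.finrank_le (LinearMap.range (f ∘ₗ Φ))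
    rw [Module.finrank_fin_fun] at h1
    omega
  · rintro _ ⟨t, ht, rfl⟩
    refine ⟨ht, ?_⟩
    let K : Submodule ℝ HRad :=
      { carrier := {w | ∀ᵐ x ∂discMeasure, ∃ t : ℝ, w.toFun x = t • z}
        zero_mem' := by
          filter_upwards [Lp.coeFn_zero ℂ 2 discMeasure] with x hx
          exact ⟨0, by rw [zero_smul]; exact hx⟩
        add_mem' := by
          intro p q hp hq
          filter_upwards [hp, hq, Lp.coeFn_add p.toFun q.toFun] with x ⟨s, hs⟩ ⟨t, ht⟩ h3
          refine ⟨s + t, ?_⟩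
          rw [HRad.toFun_add, h3, Pi.add_apply, hs, ht, add_smul]
        smul_mem' := by
          intro r p hp
          filter_upwards [hp, Lp.coeFn_smul r p.toFun] with x ⟨s, hs⟩ h3
          refine ⟨r * s, ?_⟩
          rw [HRad.toFun_smul, h3, Pi.smul_apply, hs, mul_smul] }
    have hK : ∀ j, e j ∈ K := fun j => by
      filter_upwards [HRad.shell_toFun (z := z) hh (hc1 j)] with x hx
      exact ⟨_, hx⟩
    have : Φ t ∈ K := by
      rw [hΦ]
      exact K.sum_mem fun j _ => K.smul_mem _ (hK j)
    exact this
  · rintro _ ⟨t, -, rfl⟩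
    have h1 := inner_sum_smul_of_orthogonal (ContinuousLinearMap.id ℝ HRad) e he0 t
    rw [hΦ, inner_sum_smul_of_orthogonal (potentialOp V hV) e heT t, ← real_inner_self_eq_norm_sq]
    simp only [ContinuousLinearMap.id_apply] at h1
    rw [h1, Finset.mul_sum, Finset.mul_sum]
    refine Finset.sum_le_sum fun j _ => ?_
    have := mul_le_mul_of_nonneg_left (hform j) (sq_nonneg (t j))
    linarith

end RadialDisc

/-! ### The ground state exceeds one -/

/-- At a local maximum the second derivative is nonpositive. -/
theorem IsLocalMax.deriv_deriv_nonpos {g : ℝ → ℝ} {t : ℝ} (h : IsLocalMax g t)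
    (hc : ContinuousAt g t) : deriv (deriv g) t ≤ 0 := by
  by_contra! hpos
  -- A point that is both a local maximum and a local minimum has a constant neighbourhood, where
  -- the second derivative vanishes.
  have hmin := isLocalMin_of_deriv_deriv_pos hpos h.deriv_eq_zero hc
  have hconst : g =ᶠ[nhds t] fun _ => g t := by
    filter_upwards [h, hmin] with s h1 h2
    exact le_antisymm h1 h2
  have h1 : deriv (deriv g) t = 0 := by
    rw [hconst.deriv.deriv_eq]
    simp
  linarith

namespace RadialDisc

/-- Perturbed second-derivative test. -/
lemma fderiv_fderiv_add_le_of_isLocalMax {Q : Plane → ℝ} (hQ : ContDiff ℝ ∞ Q) {ε : ℝ} {x v : Plane}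
    (hv : ‖v‖ = 1) (hmax : IsLocalMax (fun y => Q y + ε * ‖y‖ ^ 2) x) :
    fderiv ℝ (fderiv ℝ Q) x v v + 2 * ε ≤ 0 := by
  have hγ : ∀ t : ℝ, HasDerivAt (fun t : ℝ => x + t • v) v t := fun t => by
    simpa using ((hasDerivAt_id t).smul_const v).const_add x
  have hQ' : ContDiff ℝ ∞ (fderiv ℝ Q) := hQ.fderiv_right (by simp)
  have hd1 : ∀ t : ℝ, HasDerivAt (fun t : ℝ => Q (x + t • v)) (fderiv ℝ Q (x + t • v) v) t :=
    fun t => ((hQ.differentiable (by simp) _).hasFDerivAt).comp_hasDerivAt t (hγ t)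
  have hd2 : HasDerivAt (fun t : ℝ => fderiv ℝ Q (x + t • v) v)
      (fderiv ℝ (fderiv ℝ Q) (x + (0 : ℝ) • v) v v) 0 := by
    have h1 := ((hQ'.differentiable (by simp) (x + (0 : ℝ) • v)).hasFDerivAt).comp_hasDerivAt
      (0 : ℝ) (hγ 0)
    exact (h1.clm_apply (hasDerivAt_const _ v)).congr_deriv (by simp)
  have hn : ∀ t : ℝ, ‖x + t • v‖ ^ 2 = ‖x‖ ^ 2 + 2 * ⟪x, v⟫_ℝ * t + t ^ 2 := fun t => by
    rw [norm_add_sq_real, real_inner_smul_right, norm_smul, hv, mul_one, Real.norm_eq_abs, sq_abs]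
    ring
  set g : ℝ → ℝ := fun t => Q (x + t • v) + ε * ‖x + t • v‖ ^ 2 with hg
  have hg1 : ∀ t, HasDerivAt g (fderiv ℝ Q (x + t • v) v + ε * (2 * ⟪x, v⟫_ℝ + 2 * t)) t :=
    fun t => by
      simp only [hg, hn]
      refine (hd1 t).add (HasDerivAt.const_mul ε ?_)
      have := (((hasDerivAt_id t).const_mul (2 * ⟪x, v⟫_ℝ)).const_add (‖x‖ ^ 2)).add
        ((hasDerivAt_id t).pow 2)
      exact this.congr_deriv (by simp)
  have hg2 : deriv g = fun t => fderiv ℝ Q (x + t • v) v + ε * (2 * ⟪x, v⟫_ℝ + 2 * t) :=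
    funext fun t => (hg1 t).deriv
  have hg3 : deriv (deriv g) 0 = fderiv ℝ (fderiv ℝ Q) x v v + 2 * ε := by
    rw [hg2]
    have := hd2.add ((((hasDerivAt_id (0 : ℝ)).const_mul 2).const_add (2 * ⟪x, v⟫_ℝ)).const_mul ε)
    rw [zero_smul, add_zero] at this
    refine this.deriv.trans ?_
    ring
  have hmaxg : IsLocalMax g 0 := by
    have hc : Filter.Tendsto (fun t : ℝ => x + t • v) (nhds 0) (nhds x) := by
      have := (hγ 0).continuousAt.tendsto
      simpa using this
    have := hc.eventually hmax
    simpa [IsLocalMax, IsMaxFilter, hg] using this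
  rw [← hg3]
  exact hmaxg.deriv_deriv_nonpos (hg1 0).continuousAt

namespace IsGroundState

variable {Q : Plane → ℝ}

lemma exists_le_of_norm_ge (hQ : IsGroundState Q) {q : ℝ} (hq : 0 < q) : ∃ K : ℝ, 1 ≤ K ∧ ∀ y, K ≤ ‖y‖ → Q y ≤ q := by
  obtain ⟨C, c, hc, hd⟩ := hQ.decay
  have h1 : Filter.Tendsto (fun r : ℝ => C * Real.exp (-c * r)) Filter.atTop (nhds 0) := by
    have h2 : Filter.Tendsto (fun r : ℝ => -c * r) Filter.atTop Filter.atBot :=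
      Filter.tendsto_id.const_mul_atTop_of_neg (neg_lt_zero.2 hc)
    simpa using (Real.tendsto_exp_atBot.comp h2).const_mul C
  obtain ⟨K, hK⟩ := Filter.eventually_atTop.1 (h1.eventually (ge_mem_nhds hq))
  exact ⟨max K 1, le_max_right _ _, fun y hy =>
    (hd y).trans (hK _ ((le_max_left _ _).trans hy))⟩

lemma exists_bound (hQ : IsGroundState Q) : ∃ M : ℝ, 0 < M ∧ ∀ y, Q y ≤ M := by
  obtain ⟨C, c, hc, hd⟩ := hQ.decay
  have h0 : 0 < C := by
    have := (hQ.pos 0).trans_le (hd 0)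
    simpa using this
  refine ⟨C, h0, fun y => (hd y).trans ?_⟩
  have : Real.exp (-c * ‖y‖) ≤ 1 := by
    rw [Real.exp_le_one_iff]
    have := mul_nonneg hc.le (norm_nonneg y)
    linarith
  nlinarith

/-- The ground state exceeds `1` somewhere: otherwise it would be subharmonic. -/
theorem exists_one_lt (hQ : IsGroundState Q) : ∃ y, 1 < Q y := by
  by_contra! hle
  have hlap : ∀ x, 0 ≤ (Δ Q) x := fun x => by
    have h1 := hQ.equation x
    have h2 := hQ.pos x
    have h3 := hle x
    have h4 : Q x ^ 3 ≤ Q x := by nlinarith [mul_nonneg h2.le (sub_nonneg.2 h3)]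
    linarith
  obtain ⟨K, hK1, hK⟩ := hQ.exists_le_of_norm_ge (half_pos (hQ.pos 0))
  have hK0 : 0 < K := by linarith
  -- With `ε K² = Q 0 / 4`, the perturbed function is at most `3 Q 0 / 4` on the circle of radius
  -- `K`, below its value at the origin. An interior maximum would force `ΔQ ≤ -4ε`.
  set ε := Q 0 / (4 * K ^ 2) with hε
  have hε0 : 0 < ε := div_pos (hQ.pos 0) (by positivity)
  have hcont : Continuous fun y => Q y + ε * ‖y‖ ^ 2 := by
    have := hQ.smooth.continuous
    fun_prop
  obtain ⟨x, hx, hxmax⟩ := (isCompact_closedBall (0 : Plane) K).exists_isMaxOn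
    ⟨0, by simp [hK0.le]⟩ hcont.continuousOn
  have hxK : ‖x‖ ≤ K := by simpa using hx
  rcases hxK.lt_or_eq with hlt | heq
  · have hloc : IsLocalMax (fun y => Q y + ε * ‖y‖ ^ 2) x :=
      hxmax.isLocalMax (Filter.mem_of_superset (Metric.isOpen_ball.mem_nhds
        (by simpa using hlt)) Metric.ball_subset_closedBall)
    have h1 := hlap x
    rw [InnerProductSpace.laplacian_eq_iteratedFDeriv_stdOrthonormalBasis] at h1
    simp only [iteratedFDeriv_two_apply] at h1
    have h2 : ∑ i, fderiv ℝ (fderiv ℝ Q) x (stdOrthonormalBasis ℝ Plane i)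
        (stdOrthonormalBasis ℝ Plane i) ≤ ∑ _i : Fin (Module.finrank ℝ Plane), -(2 * ε) :=
      Finset.sum_le_sum fun i _ => by
        have := fderiv_fderiv_add_le_of_isLocalMax hQ.smooth
          ((stdOrthonormalBasis ℝ Plane).orthonormal.1 i) hloc
        linarith
    have h3 : ∑ _i : Fin (Module.finrank ℝ Plane), -(2 * ε) = -(4 * ε) := by
      simp
      ring
    have h4 : 0 ≤ ∑ i, fderiv ℝ (fderiv ℝ Q) x (stdOrthonormalBasis ℝ Plane i)
        (stdOrthonormalBasis ℝ Plane i) := h1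
    linarith
  · have h1 := hxmax (show (0 : Plane) ∈ Metric.closedBall 0 K by simp [hK0.le])
    have h2 : Q 0 + ε * ‖(0 : Plane)‖ ^ 2 ≤ Q x + ε * ‖x‖ ^ 2 := h1
    have h3 := hK x heq.ge
    have h4 : ε * K ^ 2 = Q 0 / 4 := by rw [hε]; field_simp
    rw [heq, h4, norm_zero] at h2
    have := hQ.pos 0
    linarith

lemma exists_shell_one_lt (hQ : IsGroundState Q) : ∃ a b q : ℝ, 0 ≤ a ∧ a < b ∧ 1 < q ∧
    ∀ y : Plane, a < ‖y‖ ^ 2 → ‖y‖ ^ 2 < b → q ≤ Q y := by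
  obtain ⟨y₀, hy₀⟩ := hQ.exists_one_lt
  have hrad : ∀ y : Plane, Q y = Q (‖y‖ • EuclideanSpace.single 0 1) := fun y =>
    hQ.radial _ _ (by simp [norm_smul])
  have hc : Continuous fun r : ℝ => Q (r • EuclideanSpace.single 0 1) :=
    hQ.smooth.continuous.comp (by fun_prop)
  have hq : (1 + Q y₀) / 2 < Q (‖y₀‖ • EuclideanSpace.single 0 1) := by
    rw [← hrad]; linarith
  obtain ⟨ε, hε, hball⟩ := Metric.eventually_nhds_iff.1
    (hc.continuousAt.eventually (lt_mem_nhds hq))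
  refine ⟨‖y₀‖ ^ 2, (‖y₀‖ + ε) ^ 2, (1 + Q y₀) / 2, by positivity, ?_, by linarith,
    fun y h1 h2 => ?_⟩
  · gcongr; linarith
  · have h3 : ‖y₀‖ < ‖y‖ := lt_of_pow_lt_pow_left₀ 2 (norm_nonneg _) h1
    have h4 : ‖y‖ < ‖y₀‖ + ε := lt_of_pow_lt_pow_left₀ 2 (by positivity) h2
    rw [hrad y]
    refine (hball ?_).le
    rw [Real.dist_eq, abs_lt]
    constructor <;> linarith

end IsGroundState

/-! ### Eigenvalue bounds for compressions to `W` -/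

lemma IsPosEigenvalueList.isNegEigenvalueList {A : HRad →L[ℝ] HRad} {l : ℕ → ℝ}
    (h : IsPosEigenvalueList (-A) l) : IsNegEigenvalueList A fun n => -l n where
  monotone := fun _ _ hmn => neg_le_neg (h.antitone hmn)
  neg := fun n => neg_lt_zero.2 (h.pos n)
  multiplicity := fun μ hμ => by
    have h1 := h.multiplicity (-μ) (neg_pos.2 hμ)
    have h2 : Module.End.eigenspace ((-A : HRad →L[ℝ] HRad) : HRad →ₗ[ℝ] HRad) (-μ) =
        Module.End.eigenspace (A : HRad →ₗ[ℝ] HRad) μ := by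
      ext v
      rw [Module.End.mem_eigenspace_iff, Module.End.mem_eigenspace_iff]
      change -(A v) = -μ • v ↔ A v = μ • v
      rw [neg_smul, neg_inj]
    rw [h2] at h1
    rw [← h1]
    simp only [neg_eq_iff_eq_neg]

/-- Eigenvalue lists of a compressed compact symmetric operator from min-max data. -/
theorem exists_eigenvalue_lists (W : Submodule ℝ HRad) [CompleteSpace W] {T : HRad →L[ℝ] HRad}
    (hc : IsCompactOperator T) (hs : (T : HRad →ₗ[ℝ] HRad).IsSymmetric) {p q C : ℕ → ℝ}
    (hp0 : ∀ n, 0 < p n) (hq0 : ∀ n, 0 < q n) (hC0 : ∀ n, 0 ≤ C n)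
    (hp : ∀ n, ∃ F : Submodule ℝ HRad, F ≤ W ∧ n < Module.finrank ℝ F ∧
      ∀ w ∈ F, p n * ‖w‖ ^ 2 ≤ ⟪T w, w⟫_ℝ)
    (hq : ∀ n, ∃ F : Submodule ℝ HRad, F ≤ W ∧ n < Module.finrank ℝ F ∧
      ∀ w ∈ F, q n * ‖w‖ ^ 2 ≤ -⟪T w, w⟫_ℝ)
    (hC : ∀ n, ∃ (N : ℕ) (f : HRad →ₗ[ℝ] (Fin N → ℂ)), 2 * N ≤ n ∧
      ∀ w, f w = 0 → -⟪T w, w⟫_ℝ ≤ C n * ‖w‖ ^ 2) :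
    ∃ lpos lneg : ℕ → ℝ,
      IsPosEigenvalueList (W.starProjection ∘L T ∘L W.starProjection) lpos ∧
      IsNegEigenvalueList (W.starProjection ∘L T ∘L W.starProjection) lneg ∧
      ∀ n, p n ≤ lpos n ∧ -C n ≤ lneg n := by
  set A := W.starProjection ∘L T ∘L W.starProjection with hA
  have hform : ∀ v w, ⟪A v, w⟫_ℝ = ⟪T (W.starProjection v), W.starProjection w⟫_ℝ := fun v w =>
    W.inner_starProjection_left_eq_right _ _
  have hAs : (A : HRad →ₗ[ℝ] HRad).IsSymmetric := fun v w => by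
    change ⟪A v, w⟫_ℝ = ⟪v, A w⟫_ℝ
    rw [hform, real_inner_comm (A w) v, hform, real_inner_comm (W.starProjection v)]
    exact hs _ _
  have hAc : IsCompactOperator A := (hc.comp_clm W.starProjection).clm_comp W.starProjection
  have hAs' : ((-A : HRad →L[ℝ] HRad) : HRad →ₗ[ℝ] HRad).IsSymmetric := fun v w => by
    change ⟪-(A v), w⟫_ℝ = ⟪v, -(A w)⟫_ℝ
    rw [inner_neg_left, inner_neg_right]
    exact congrArg _ (hAs v w)
  have hAF : ∀ F : Submodule ℝ HRad, F ≤ W → ∀ w ∈ F, ⟪A w, w⟫_ℝ = ⟪T w, w⟫_ℝ :=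
    fun F hF w hw => by
      rw [hform, Submodule.starProjection_eq_self_iff.2 (hF hw)]
  obtain ⟨l, hl1, hl2, hl3, hl4, -⟩ := exists_positive_eigenvalue_list hAc hAs fun n => by
    obtain ⟨F, hFW, hF, hFp⟩ := hp n
    refine ⟨F, hF, fun w hw hw0 => ?_⟩
    rw [hAF F hFW w hw]
    exact lt_of_lt_of_le (mul_pos (hp0 n) (by positivity)) (hFp w hw)
  obtain ⟨m, hm1, hm2, hm3, -, hm5⟩ := exists_positive_eigenvalue_list hAc.neg hAs' fun n => by
    obtain ⟨F, hFW, hF, hFp⟩ := hq n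
    refine ⟨F, hF, fun w hw hw0 => ?_⟩
    change 0 < ⟪-(A w), w⟫_ℝ
    rw [inner_neg_left, hAF F hFW w hw]
    exact lt_of_lt_of_le (mul_pos (hq0 n) (by positivity)) (hFp w hw)
  refine ⟨l, fun n => -m n, ⟨hl1, hl2, hl3⟩, IsPosEigenvalueList.isNegEigenvalueList ⟨hm1, hm2, hm3⟩,
    fun n => ⟨?_, neg_le_neg ?_⟩⟩
  · obtain ⟨F, hFW, hF, hFp⟩ := hp n
    exact hl4 n _ F hF fun w hw => by rw [hAF F hFW w hw]; exact hFp w hw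
  · obtain ⟨N, f, hN, hf⟩ := hC n
    -- The conditions are imposed on the projection of `w`, so `W` itself costs no codimension; `N`
    -- complex conditions count as `2N` real ones. Nonnegativity of `C n` lets the contraction
    -- property of the projection finish.
    refine hm5 n (C n) (Fin N → ℂ) (f ∘ₗ (W.starProjection : HRad →ₗ[ℝ] HRad)) ?_ fun w hw => ?_
    · rw [Module.finrank_pi_fintype]
      simpa [Complex.finrank_real_complex, mul_comm] using hN
    · change ⟪-(A w), w⟫_ℝ ≤ _
      rw [inner_neg_left, hform]
      refine (hf _ hw).trans ?_
      gcongr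
      · exact hC0 n
      · exact W.norm_starProjection_apply_le w

/-- A potential of depth `m δ⁻²` inside the disc of radius `Kδ` that is at least `δ⁻²/4` outside has
negative form of codimension-`k` size `O(k⁻²)`, uniformly in `δ`. -/
theorem exists_neg_form_le {V : Plane → ℝ} (hV : Continuous V) {m K L δ : ℝ} (hm : 0 < m)
    (hK : 0 < K) (hδ : 0 < δ) (hL0 : 0 < L) (hL : L ^ 2 = K ^ 2 * (1 + 16 * m)) (hLδ : L * δ ≤ 1)
    (hlow : ∀ x, -((δ ^ 2)⁻¹ * m) ≤ V x) (hout : ∀ x : Plane, K * δ ≤ ‖x‖ → (δ ^ 2)⁻¹ / 4 ≤ V x)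
    (k : ℕ) :
    ∃ (N : ℕ) (f : HRad →ₗ[ℝ] (Fin N → ℂ)), 2 * N ≤ k ∧ ∀ w, f w = 0 →
      -⟪potentialOp V hV w, w⟫_ℝ ≤
        ((16 * m * K ^ 2 + 4 * (2 * m + 1 / 4) * L ^ 2) / ((k : ℝ) + 1) ^ 2) * ‖w‖ ^ 2 := by
  have hKL : K < L := by
    have : K ^ 2 < L ^ 2 := by rw [hL]; nlinarith [mul_pos (pow_pos hK 2) hm]
    exact lt_of_pow_lt_pow_left₀ 2 hL0.le this
  have hKδ : 0 < K * δ := mul_pos hK hδ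
  have hKLδ : K * δ < L * δ := mul_lt_mul_of_pos_right hKL hδ
  have hsplit : ∀ w : HRad, -⟪potentialOp V hV w, w⟫_ℝ ≤
      (δ ^ 2)⁻¹ * (m * ∫ x in annulus 0 (K * δ), ‖w.toFun x‖ ^ 2 ∂discMeasure) -
      (δ ^ 2)⁻¹ / 4 * ∫ x in annulus (K * δ) (L * δ), ‖w.toFun x‖ ^ 2 ∂discMeasure := by
    intro w
    rw [inner_potentialOp_self, ← integral_neg, ← mul_assoc, ← integral_const_mul,
      ← integral_const_mul, ← integral_indicator (measurableSet_annulus _ _),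
      ← integral_indicator (measurableSet_annulus _ _), ← integral_sub]
    · refine integral_mono (integrable_mul_norm_sq hV w).neg
        (((w.integrable_norm_sq.const_mul _).indicator (measurableSet_annulus _ _)).sub
          ((w.integrable_norm_sq.const_mul _).indicator (measurableSet_annulus _ _))) fun x => ?_
      have h0 : 0 ≤ ‖w.toFun x‖ ^ 2 := sq_nonneg _
      have h1 := mul_le_mul_of_nonneg_right (hlow x) h0
      by_cases hx : ‖x‖ < K * δ
      · have hA : x ∈ annulus 0 (K * δ) := ⟨norm_nonneg _, hx⟩
        have hB : x ∉ annulus (K * δ) (L * δ) := fun h => absurd hx (not_lt.2 h.1)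
        simp only [Set.indicator_of_mem hA, Set.indicator_of_notMem hB]
        linarith
      · have hA : x ∉ annulus 0 (K * δ) := fun h => hx h.2
        have h2 := mul_le_mul_of_nonneg_right (hout x (not_lt.1 hx)) h0
        have h3 : 0 ≤ (δ ^ 2)⁻¹ / 4 * ‖w.toFun x‖ ^ 2 := by positivity
        simp only [Set.indicator_of_notMem hA]
        by_cases hB : x ∈ annulus (K * δ) (L * δ)
        · simp only [Set.indicator_of_mem hB]
          linarith
        · simp only [Set.indicator_of_notMem hB]
          linarith
    · exact (w.integrable_norm_sq.const_mul _).indicator (measurableSet_annulus _ _)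
    · exact (w.integrable_norm_sq.const_mul _).indicator (measurableSet_annulus _ _)
  -- For `k < 2` there is no room for a complex mean condition.
  rcases lt_or_ge k 2 with hk | hk
  · refine ⟨0, 0, by omega, fun w _ => (hsplit w).trans ?_⟩
    have h1 := w.setIntegral_ball_le hKδ hKLδ hLδ
    set IA := ∫ x in annulus 0 (K * δ), ‖w.toFun x‖ ^ 2 ∂discMeasure
    set IB := ∫ x in annulus (K * δ) (L * δ), ‖w.toFun x‖ ^ 2 ∂discMeasure
    -- `L` is chosen for this identity: after dividing by `4 (K δ)²`, the outer mass enters with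
    -- coefficient one and is cancelled exactly by the term `δ⁻²/4` of the potential.
    have e1 : (L * δ) ^ 2 - (K * δ) ^ 2 = (K * δ) ^ 2 * (16 * m) := by
      rw [mul_pow, hL]; ring
    rw [e1] at h1
    have h2 : 4 * m * IA ≤ (8 * m + 1) * ((L * δ) ^ 2 * ‖w‖ ^ 2) + IB := by
      have : 0 < 4 * (K * δ) ^ 2 := by positivity
      refine le_of_mul_le_mul_left ?_ this
      linarith
    have h3 : (δ ^ 2)⁻¹ * (m * IA) - (δ ^ 2)⁻¹ / 4 * IB ≤ (2 * m + 1 / 4) * L ^ 2 * ‖w‖ ^ 2 := by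
      have h4 := mul_le_mul_of_nonneg_left h2 (by positivity : 0 ≤ (δ ^ 2)⁻¹ / 4)
      have h5 : (δ ^ 2)⁻¹ / 4 * ((8 * m + 1) * ((L * δ) ^ 2 * ‖w‖ ^ 2)) =
          (2 * m + 1 / 4) * L ^ 2 * ‖w‖ ^ 2 := by
        field_simp
        ring
      linarith
    refine h3.trans (mul_le_mul_of_nonneg_right ?_ (sq_nonneg _))
    have hk' : (k : ℝ) + 1 ≤ 2 := by
      have : (k : ℝ) ≤ 1 := by exact_mod_cast Nat.lt_succ_iff.1 hk
      linarith
    rw [le_div_iff₀ (by positivity)]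
    have h6 : ((k : ℝ) + 1) ^ 2 ≤ 4 := by nlinarith [Nat.cast_nonneg (α := ℝ) k]
    have h7 : 0 ≤ (2 * m + 1 / 4) * L ^ 2 := by positivity
    have h8 : 0 ≤ 16 * m * K ^ 2 := by positivity
    nlinarith [mul_le_mul_of_nonneg_left h6 h7]
  -- Here the outer contribution is dropped. Since `k + 1 ≤ 4 (k / 2)` for `k ≥ 2`, passing from `(k
  -- / 2)²` to `(k + 1)²` costs the factor `16`.
  · refine ⟨k / 2, HRad.annuliIntegrals (K * δ) (k / 2), by omega, fun w hw => (hsplit w).trans ?_⟩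
    have hN : 0 < k / 2 := by omega
    have h1 := w.setIntegral_ball_le_of_annuliIntegrals_eq_zero hKδ (hKLδ.le.trans hLδ) hN hw
    rw [← annulus_zero] at h1
    set N := k / 2
    set IA := ∫ x in annulus 0 (K * δ), ‖w.toFun x‖ ^ 2 ∂discMeasure
    have hIB : 0 ≤ ∫ x in annulus (K * δ) (L * δ), ‖w.toFun x‖ ^ 2 ∂discMeasure :=
      integral_nonneg fun _ => sq_nonneg _
    set IB := ∫ x in annulus (K * δ) (L * δ), ‖w.toFun x‖ ^ 2 ∂discMeasure
    have hN' : (0 : ℝ) < N := by exact_mod_cast hN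
    have h2 : (δ ^ 2)⁻¹ * (m * IA) ≤ m * K ^ 2 / N ^ 2 * ‖w‖ ^ 2 := by
      have h3 := mul_le_mul_of_nonneg_left h1 (by positivity : 0 ≤ (δ ^ 2)⁻¹ * m)
      have h4 : (δ ^ 2)⁻¹ * m * ((K * δ / N) ^ 2 * ‖w‖ ^ 2) = m * K ^ 2 / N ^ 2 * ‖w‖ ^ 2 := by
        field_simp
      linarith
    have h5 : 0 ≤ (δ ^ 2)⁻¹ / 4 * IB := by positivity
    have h6 : m * K ^ 2 / (N : ℝ) ^ 2 ≤
        (16 * m * K ^ 2 + 4 * (2 * m + 1 / 4) * L ^ 2) / ((k : ℝ) + 1) ^ 2 := by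
      rw [div_le_div_iff₀ (by positivity) (by positivity)]
      have h7 : (k : ℝ) + 1 ≤ 4 * N := by
        have : k + 1 ≤ 4 * N := by omega
        exact_mod_cast this
      have h8 : ((k : ℝ) + 1) ^ 2 ≤ 16 * (N : ℝ) ^ 2 := by nlinarith [Nat.cast_nonneg (α := ℝ) k]
      have h9 := mul_le_mul_of_nonneg_left h8 (by positivity : 0 ≤ m * K ^ 2)
      have h10 : 0 ≤ 4 * (2 * m + 1 / 4) * L ^ 2 * (N : ℝ) ^ 2 := by positivity
      linarith
    have h11 := mul_le_mul_of_nonneg_right h6 (sq_nonneg ‖w‖)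
    linarith

/-- Eigenvalue lists with bounds for the compression of a potential operator. -/
theorem exists_eigenvalue_lists_of_potential {V : Plane → ℝ} (hV : Continuous V)
    {m K L δ a b v : ℝ} (hm : 0 < m) (hK : 0 < K) (hδ : 0 < δ) (hL0 : 0 < L)
    (hL : L ^ 2 = K ^ 2 * (1 + 16 * m)) (hLδ : L * δ ≤ 1) (hKδ : K * δ ≤ 1 / 2)
    (hlow : ∀ x, -((δ ^ 2)⁻¹ * m) ≤ V x) (hout : ∀ x : Plane, K * δ ≤ ‖x‖ → (δ ^ 2)⁻¹ / 4 ≤ V x)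
    (ha : 0 ≤ a) (hab : a < b) (hb : b ≤ 1) (hv : 0 < v)
    (hin : ∀ x : Plane, a < ‖x‖ ^ 2 → ‖x‖ ^ 2 < b → V x ≤ -v)
    (W : Submodule ℝ HRad) [CompleteSpace W] {z : ℂ} (hz : ‖z‖ = 1) {G : Type} [AddCommGroup G]
    [Module ℝ G] [FiniteDimensional ℝ G] (hG : Module.finrank ℝ G ≤ 2) (f : HRad →ₗ[ℝ] G)
    (hW : ∀ w, f w = 0 → (∀ᵐ x ∂discMeasure, ∃ t : ℝ, w.toFun x = t • z) → w ∈ W) :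
    ∃ lpos lneg : ℕ → ℝ,
      IsPosEigenvalueList (W.starProjection ∘L potentialOp V hV ∘L W.starProjection) lpos ∧
      IsNegEigenvalueList (W.starProjection ∘L potentialOp V hV ∘L W.starProjection) lneg ∧
      ∀ n : ℕ, 1 ≤ n →
        1 / (8192 * bumpSlope ^ 2) * (δ ^ (-2 : ℤ) / (n : ℝ) ^ 2) ≤ lpos (n - 1) ∧
        -((16 * m * K ^ 2 + 4 * (2 * m + 1 / 4) * L ^ 2) / (n : ℝ) ^ 2) ≤ lneg (n - 1) := by
  -- Where `‖x‖² > 1/4`, one has `‖x‖ > 1/2 ≥ K δ`, so the positive bumps live in a region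
  -- independent of `δ`.
  have hS := bumpSlope_pos
  have hpos := exists_subspace_le_form hV (σ := 1) (v := (δ ^ 2)⁻¹ / 4) (a := 1 / 4) (b := 1)
    (by positivity) (by norm_num) (by norm_num) le_rfl (fun x h1 _ => by
      rw [one_mul]
      refine hout x (hKδ.trans ?_)
      nlinarith [norm_nonneg x]) hz f
  have hneg := exists_subspace_le_form hV (σ := -1) hv ha hab hb (fun x h1 h2 => by
      linarith [hin x h1 h2]) hz f
  obtain ⟨lpos, lneg, h1, h2, h3⟩ := exists_eigenvalue_lists W (isCompactOperator_potentialOp hV)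
    (isSymmetric_potentialOp hV)
    (p := fun n => (δ ^ 2)⁻¹ / 4 * (1 - 1 / 4) ^ 2 /
      (128 * bumpSlope ^ 2 * (n + 1 + Module.finrank ℝ G : ℕ) ^ 2))
    (q := fun n => v * (b - a) ^ 2 / (128 * bumpSlope ^ 2 * (n + 1 + Module.finrank ℝ G : ℕ) ^ 2))
    (C := fun n => (16 * m * K ^ 2 + 4 * (2 * m + 1 / 4) * L ^ 2) / ((n : ℝ) + 1) ^ 2)
    (fun n => by positivity)
    (fun n => by have := sub_pos.2 hab; positivity) (fun n => by positivity)
    (fun n => by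
      obtain ⟨F, hF1, hF2, hF3⟩ := hpos n
      exact ⟨F, fun w hw => hW w (hF2 w hw).1 (hF2 w hw).2, hF1, fun w hw => by
        simpa using hF3 w hw⟩)
    (fun n => by
      obtain ⟨F, hF1, hF2, hF3⟩ := hneg n
      exact ⟨F, fun w hw => hW w (hF2 w hw).1 (hF2 w hw).2, hF1, fun w hw => by
        simpa using hF3 w hw⟩)
    (exists_neg_form_le hV hm hK hδ hL0 hL hLδ hlow hout)
  refine ⟨lpos, lneg, h1, h2, fun n hn => ?_⟩
  obtain ⟨h4, h5⟩ := h3 (n - 1)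
  have hn1 : ((n - 1 : ℕ) : ℝ) + 1 = n := by exact_mod_cast Nat.sub_add_cancel hn
  have hn0 : (1 : ℝ) ≤ n := by exact_mod_cast hn
  refine ⟨le_trans ?_ h4, ?_⟩
  -- At most two constraints give `n + 2 ≤ 3n`. The constant is `(1/4)(3/4)² / (128 · 9) = 1/8192`,
  -- apart from `bumpSlope²`.
  · have h6 : ((n - 1 + 1 + Module.finrank ℝ G : ℕ) : ℝ) ≤ 3 * n := by
      have : n - 1 + 1 + Module.finrank ℝ G ≤ 3 * n := by omega
      exact_mod_cast this
    calc 1 / (8192 * bumpSlope ^ 2) * (δ ^ (-2 : ℤ) / (n : ℝ) ^ 2)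
        = (δ ^ 2)⁻¹ / 4 * (1 - 1 / 4) ^ 2 / (128 * bumpSlope ^ 2 * (3 * n) ^ 2) := by
          rw [zpow_neg, show (δ : ℝ) ^ (2 : ℤ) = δ ^ 2 by norm_cast]
          field_simp
          norm_num
      _ ≤ _ := by gcongr
  · simpa only [hn1] using h5

/-! ### Uniform pointwise bounds on the potential -/

/-- The pointwise bounds on `-(1 + 5η) κ 𝐐_δ² + δ⁻²/2` behind the spectral estimates. -/
theorem exists_potential_bounds {Q : Plane → ℝ} (hQ : IsGroundState Q) (η₀ : ℝ) (hη₀ : 0 < η₀) :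
    ∃ m K L a b v δ₀ : ℝ, 0 < m ∧ 0 < K ∧ 0 < L ∧ L ^ 2 = K ^ 2 * (1 + 16 * m) ∧ 0 ≤ a ∧ a < b ∧
      0 < v ∧ 0 < δ₀ ∧ ∀ κ η δ : ℝ, 1 / 2 ≤ κ → κ ≤ 3 / 2 → 0 < η → η ≤ η₀ → 0 < δ → δ < δ₀ →
        L * δ ≤ 1 ∧ K * δ ≤ 1 / 2 ∧ δ ^ 2 * b ≤ 1 ∧
        (∀ x, -((δ ^ 2)⁻¹ * m) ≤ potential Q κ η δ x) ∧
        (∀ x : Plane, K * δ ≤ ‖x‖ → (δ ^ 2)⁻¹ / 4 ≤ potential Q κ η δ x) ∧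
        (∀ x : Plane, δ ^ 2 * a < ‖x‖ ^ 2 → ‖x‖ ^ 2 < δ ^ 2 * b →
          potential Q κ η δ x ≤ -((δ ^ 2)⁻¹ * v)) := by
  obtain ⟨M, hM0, hM⟩ := hQ.exists_bound
  obtain ⟨a, b, q₁, ha, hab, hq₁, hin⟩ := hQ.exists_shell_one_lt
  -- The largest possible coefficient `(1 + 5η) κ`.
  set g := (1 + 5 * η₀) * (3 / 2) with hg
  have hg1 : 1 ≤ g := by rw [hg]; linarith
  -- `q` bounds both the boundary value `β` and `Q` beyond radius `K`. Its first entry keeps `Q - β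
  -- ≥ (q₁ + 1)/2 > 1` on the shell; its second gives `g q² ≤ 1/4`, hence `1/2 - g q² ≥ 1/4` far
  -- out.
  set q := min ((q₁ - 1) / 2) (1 / (2 * g)) with hq
  have hq0 : 0 < q := lt_min (by linarith) (by positivity)
  obtain ⟨K, hK1, hK⟩ := hQ.exists_le_of_norm_ge hq0
  have hK0 : 0 < K := by linarith
  set m := g * M ^ 2 with hm
  have hm0 : 0 < m := by positivity
  set L := K * √(1 + 16 * m) with hL
  have hs1 : 1 ≤ √(1 + 16 * m) := by rw [Real.one_le_sqrt]; linarith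
  have hKL : K ≤ L := by rw [hL]; nlinarith
  have hL0 : 0 < L := hK0.trans_le hKL
  have hb0 : 0 < b := ha.trans_lt hab
  have hgq : g * q ^ 2 ≤ 1 / 4 := by
    have h1 : q ≤ 1 / (2 * g) := min_le_right _ _
    calc g * q ^ 2 ≤ g * (1 / (2 * g)) ^ 2 := by gcongr
      _ = 1 / (4 * g) := by field_simp; norm_num
      _ ≤ 1 / 4 := by
        rw [div_le_div_iff₀ (by positivity) (by norm_num)]
        linarith
  -- The depth `v` comes from `1/2 - (1/2)((q₁ + 1)/2)²`, using coefficient at least `1/2`. The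
  -- bound on `δ` forces `L δ`, `2 K δ`, `δ` and `δ² b` all to be at most one.
  refine ⟨m, K, L, a, b, (((q₁ + 1) / 2) ^ 2 - 1) / 2, 1 / (2 * L + b + 1), hm0, hK0, hL0, ?_, ha,
    hab, by nlinarith, by positivity, ?_⟩
  · rw [hL, mul_pow, Real.sq_sqrt (by positivity)]
  intro κ η δ hκ1 hκ2 hη hηη hδ hδδ
  rw [lt_div_iff₀ (by positivity)] at hδδ
  have hLδ : 0 < L * δ := mul_pos hL0 hδ
  have hbδ : 0 < b * δ := mul_pos hb0 hδ
  have hKδ : K * δ ≤ L * δ := by gcongr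
  have hδ1 : δ ≤ 1 := by nlinarith
  have hcoef1 : 1 / 2 ≤ (1 + 5 * η) * κ := by nlinarith
  have hcoef2 : (1 + 5 * η) * κ ≤ g := by rw [hg]; gcongr
  have hbdry : Q (δ⁻¹ • EuclideanSpace.single 0 1) ≤ q := by
    refine hK _ ?_
    rw [norm_smul, norm_inv, Real.norm_of_nonneg hδ.le, PiLp.norm_single, norm_one,
      mul_one, le_inv_comm₀ hK0 hδ, ← one_div, le_div_iff₀ hK0]
    nlinarith
  have hbdry0 : 0 < Q (δ⁻¹ • EuclideanSpace.single 0 1) := hQ.pos _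
  set β := Q (δ⁻¹ • EuclideanSpace.single 0 1) with hβ
  have hpot : ∀ x, potential Q κ η δ x =
      (δ ^ 2)⁻¹ * (1 / 2 - (1 + 5 * η) * κ * (Q (δ⁻¹ • x) - β) ^ 2) := fun x => by
    rw [potential, boldQ, scaledQ, scaledQ, ← hβ]
    field_simp
    ring
  have hδ2 : 0 < (δ ^ 2)⁻¹ := by positivity
  refine ⟨by nlinarith, by nlinarith, by nlinarith, fun x => ?_, fun x hx => ?_, fun x h1 h2 => ?_⟩
  · rw [hpot, ← mul_neg]
    refine mul_le_mul_of_nonneg_left ?_ hδ2.le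
    have h1 : (Q (δ⁻¹ • x) - β) ^ 2 ≤ M ^ 2 := by
      have := hQ.pos (δ⁻¹ • x)
      have := hM (δ⁻¹ • x)
      have : β ≤ M := hM _
      exact sq_le_sq' (by linarith) (by linarith)
    have h2 : (1 + 5 * η) * κ * (Q (δ⁻¹ • x) - β) ^ 2 ≤ g * M ^ 2 := by gcongr
    linarith
  · rw [hpot, div_eq_mul_inv]
    refine mul_le_mul_of_nonneg_left ?_ hδ2.le
    have h0 : K ≤ ‖δ⁻¹ • x‖ := by
      rw [norm_smul, norm_inv, Real.norm_of_nonneg hδ.le, inv_mul_eq_div, le_div_iff₀ hδ]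
      exact hx
    have h1 : (Q (δ⁻¹ • x) - β) ^ 2 ≤ q ^ 2 := by
      have := hQ.pos (δ⁻¹ • x)
      have := hK _ h0
      exact sq_le_sq' (by linarith) (by linarith)
    have h2 : (1 + 5 * η) * κ * (Q (δ⁻¹ • x) - β) ^ 2 ≤ g * q ^ 2 := by gcongr
    linarith
  · rw [hpot, ← mul_neg]
    refine mul_le_mul_of_nonneg_left ?_ hδ2.le
    have hn : ‖δ⁻¹ • x‖ ^ 2 = ‖x‖ ^ 2 / δ ^ 2 := by
      rw [norm_smul, norm_inv, Real.norm_of_nonneg hδ.le, mul_pow, inv_pow, inv_mul_eq_div]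
    have h3 : q₁ ≤ Q (δ⁻¹ • x) := by
      refine hin _ ?_ ?_
      · rw [hn, lt_div_iff₀ (by positivity)]; linarith
      · rw [hn, div_lt_iff₀ (by positivity)]; linarith
    have h4 : q ≤ (q₁ - 1) / 2 := min_le_left _ _
    have h5 : ((q₁ + 1) / 2) ^ 2 ≤ (Q (δ⁻¹ • x) - β) ^ 2 := by
      gcongr
      linarith
    have h6 := mul_le_mul_of_nonneg_right hcoef1 (sq_nonneg (Q (δ⁻¹ • x) - β))
    linarith

end RadialDisc

/-! ### The two operators -/

theorem proposition6p7 (Q : RadialDisc.Plane → ℝ) (hQ : RadialDisc.IsGroundState Q)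
    (η₀ : ℝ) (hη₀ : 0 < η₀) :
    ∃ δ₀ c C : ℝ, 0 < δ₀ ∧ 0 < c ∧ 0 < C ∧
      ∀ η : ℝ, 0 < η → η ≤ η₀ → ∀ (δ : ℝ) (hδ : 0 < δ), δ < δ₀ →
        (∃ lpos lneg : ℕ → ℝ,
          RadialDisc.IsPosEigenvalueList (RadialDisc.opA₁ hQ η hδ) lpos ∧
          RadialDisc.IsNegEigenvalueList (RadialDisc.opA₁ hQ η hδ) lneg ∧
          ∀ n : ℕ, 1 ≤ n →
            c * (δ ^ (-2 : ℤ) / (n : ℝ) ^ 2) ≤ lpos (n - 1) ∧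
            -(C / (n : ℝ) ^ 2) ≤ lneg (n - 1)) ∧
        (∃ lpos lneg : ℕ → ℝ,
          RadialDisc.IsPosEigenvalueList (RadialDisc.opA₂ hQ η δ) lpos ∧
          RadialDisc.IsNegEigenvalueList (RadialDisc.opA₂ hQ η δ) lneg ∧
          ∀ n : ℕ, 1 ≤ n →
            c * (δ ^ (-2 : ℤ) / (n : ℝ) ^ 2) ≤ lpos (n - 1) ∧
            -(C / (n : ℝ) ^ 2) ≤ lneg (n - 1)) := by
  obtain ⟨m, K, L, a, b, v, δ₀, hm, hK, hL0, hL, ha, hab, hv, hδ₀, hbound⟩ :=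
    RadialDisc.exists_potential_bounds hQ η₀ hη₀
  have hS := RadialDisc.bumpSlope_pos
  refine ⟨δ₀, 1 / (8192 * RadialDisc.bumpSlope ^ 2),
    16 * m * K ^ 2 + 4 * (2 * m + 1 / 4) * L ^ 2, hδ₀, by positivity, by positivity,
    fun η hη hηη δ hδ hδδ => ⟨?_, ?_⟩⟩
  · obtain ⟨h1, h2, h3, h4, h5, h6⟩ :=
      hbound (3 / 2) η δ (by norm_num) le_rfl hη hηη hδ hδδ
    -- The phase `z = 1` makes the bumps real-valued, leaving the two pairings as the only
    -- constraints.
    refine RadialDisc.exists_eigenvalue_lists_of_potential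
      (RadialDisc.continuous_potential hQ (3 / 2) η δ) hm hK hδ hL0 hL h1 h2 h4 h5
      (mul_nonneg (sq_nonneg δ) ha) (mul_lt_mul_of_pos_left hab (pow_pos hδ 2)) h3
      (mul_pos (inv_pos.2 (pow_pos hδ 2)) hv) h6 (RadialDisc.subspaceR hQ hδ) (z := 1) (by simp)
      (G := ℝ × ℝ) (by simp)
      (((RadialDisc.pairing (RadialDisc.negLapDerivBoldQ Q δ)
        (RadialDisc.continuous_negLapDerivBoldQ hQ hδ)).prod
        (RadialDisc.pairing (fun x => (RadialDisc.boldQ Q δ x : ℂ))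
          (RadialDisc.continuous_boldQ_complex hQ δ)) :
          RadialDisc.HRad →L[ℝ] ℝ × ℝ) : RadialDisc.HRad →ₗ[ℝ] ℝ × ℝ) fun w hw hz => ?_
    rw [RadialDisc.mem_subspaceR]
    refine ⟨?_, congrArg Prod.fst hw, congrArg Prod.snd hw⟩
    filter_upwards [hz] with x hx
    obtain ⟨t, ht⟩ := hx
    simp [ht]
  · obtain ⟨h1, h2, h3, h4, h5, h6⟩ :=
      hbound (1 / 2) η δ le_rfl (by norm_num) hη hηη hδ hδδ
    -- The phase `z = i` makes the bumps purely imaginary, leaving one pairing.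
    refine RadialDisc.exists_eigenvalue_lists_of_potential
      (RadialDisc.continuous_potential hQ (1 / 2) η δ) hm hK hδ hL0 hL h1 h2 h4 h5
      (mul_nonneg (sq_nonneg δ) ha) (mul_lt_mul_of_pos_left hab (pow_pos hδ 2)) h3
      (mul_pos (inv_pos.2 (pow_pos hδ 2)) hv) h6 (RadialDisc.subspaceI hQ δ) (z := Complex.I)
      (by simp) (G := ℝ) (by simp)
      (RadialDisc.pairing (RadialDisc.negLapIBoldQ Q δ)
        (RadialDisc.continuous_negLapIBoldQ hQ δ) : RadialDisc.HRad →ₗ[ℝ] ℝ) fun w hw hz => ?_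
    rw [RadialDisc.mem_subspaceI]
    refine ⟨?_, hw⟩
    filter_upwards [hz] with x hx
    obtain ⟨t, ht⟩ := hx
    simp [ht]
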